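/- All graphs are finite and simple. Conventions: - For a graph $G$ and a positive integer $r$, $G^r$ is the graph on $V(G)$ in which distinct vertices are adjacent if and only if their distance in $G$ is at most $r$. $P_n$ is the path on $n$ vertices. - For a graph $H$ and a positive integer $t$, a *sheared complete blow-up* $H\{t\}$ is any graph obtained as follows: replace each vertex $v$ of $H$ by a clique $C(v)$ on $t$ vertices, add all edges between $C(u)$ and $C(v)$ for each $uv\in E(H)$, and then, for each $uv\in E(H)$, remove a perfect matching from the complete bipartite graph between $C(u)$ and $C(v)$. (The graph $H\{t\}$ is not uniquely determined.) - For positive reals $a,b,c,\varepsilon$ and positive integers $t,n$, $\mathcal P(a,b,c,t,\varepsilon,n)$ is the class of graphs $G$ such that (i) $|V(G)|=\lceil an\rceil$; (ii) $\Delta(G)\le b$; (iii) there is $f_G>0$ such that $(1-\varepsilon)f_G\le e_G(X,Y)/(|X||Y|)\le(1+\varepsilon)f_G$ for all disjoint $X,Y\subseteq V(G)$ with $|X|=|Y|=\lceil cn\rceil$, where $e_G(X,Y)$ is the number of edges between $X$ and $Y$; (iv) $G$ has no cycle of length at most $2t$. - A quadruple $(a,b,c,\varepsilon)$ of positive reals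 is *good* if $a\ge 2c+1$, $b\ge 264\,a^2\varepsilon^{-2}c^{-2}$ and $\varepsilon<1/10$. **Lemma (Induction Step).** Let $k,s,r\ge 1$ and $t\ge 2$ be integers and let $(a,b,c,\varepsilon)$ be a good quadruple. Then there exist positive integers $R,T$, a good quadruple $(A,B,C,\delta)$ and an integer $n_0$ such that for every $n\ge n_0$, every $G\in\mathcal P(A,B,C,T,\delta,n)$, every sheared complete blow-up $G^R\{T\}$ of $G^R$, and every colouring of $E(G^R\{T\})$ with $s$ colours, at least one of the following holds: 1. $G^R\{T\}$ contains a monochromatic copy of $P_n^k$; 2. there are $H\in\mathcal P(a,b,c,t,\varepsilon,n)$ and a sheared complete blow-up $H^r\{t\}$ of $H^r$ such that $G^R\{T\}$ contains a copy of $H^r\{t\}$ on whose edges at most $s-1$ colours are used. -/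

import Mathlib

/-- The `k`-th power `G^k` of a graph: distinct vertices are adjacent iff their distance in `G`
is at most `k` (the distance between different components is `⊤`). -/
def graphPower {V : Type*} (G : SimpleGraph V) (k : ℕ) : SimpleGraph V where
  Adj u v := u ≠ v ∧ G.edist u v ≤ (k : ℕ∞)
  symm := ⟨fun u v h => ⟨h.1.symm, by rw [SimpleGraph.edist_comm]; exact h.2⟩⟩
  loopless := ⟨fun _ h => h.1 rfl⟩

/-- The complete blow-up `H(t)`: each vertex `v` becomes a clique `C(v) = {v} × Fin t`, and all
edges between `C(u)` and `C(v)` are present when `uv` is an edge of `H`. -/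
def completeBlowup {V : Type*} (H : SimpleGraph V) (t : ℕ) : SimpleGraph (V × Fin t) where
  Adj x y := (x.1 = y.1 ∧ x.2 ≠ y.2) ∨ H.Adj x.1 y.1
  symm := ⟨fun _ _ h => h.elim (fun h => Or.inl ⟨h.1.symm, h.2.symm⟩) (fun h => Or.inr h.symm)⟩
  loopless := ⟨fun _ h => h.elim (fun h => h.2 rfl) (fun h => H.irrefl h)⟩

/-- `Γ` is a sheared complete blow-up `H{t}`: it arises from `H(t)` by deleting, for each edge
`uv` of `H`, a perfect matching of the complete bipartite graph between `C(u)` and `C(v)`.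
Such a perfect matching is `{(u, i)(v, σ i) : i}` for a permutation `σ` of `Fin t`. -/
def IsShearedBlowup {V : Type*} (H : SimpleGraph V) (t : ℕ) (Γ : SimpleGraph (V × Fin t)) :
    Prop :=
  Γ ≤ completeBlowup H t ∧
  (∀ (u : V) (i j : Fin t), i ≠ j → Γ.Adj (u, i) (u, j)) ∧
  (∀ u v : V, H.Adj u v →
    ∃ σ : Equiv.Perm (Fin t), ∀ i j : Fin t, Γ.Adj (u, i) (v, j) ↔ j ≠ σ i)

open Classical in
/-- `G` belongs to the class `𝒫(a, b, c, t, ε, n)`. The sizes `an` and `cn` are rounded up. -/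
structure IsPseudorandom {V : Type*} [Fintype V] (a b c : ℝ) (t : ℕ) (ε : ℝ) (n : ℕ)
    (G : SimpleGraph V) : Prop where
  card_eq : Fintype.card V = ⌈a * n⌉₊
  maxDegree_le : (G.maxDegree : ℝ) ≤ b
  density : ∃ f : ℝ, 0 < f ∧ ∀ X Y : Finset V, Disjoint X Y →
    X.card = ⌈c * n⌉₊ → Y.card = ⌈c * n⌉₊ →
      (1 - ε) * f ≤ (G.edgeDensity X Y : ℝ) ∧ (G.edgeDensity X Y : ℝ) ≤ (1 + ε) * f
  no_short_cycle : ∀ (v : V) (w : G.Walk v v), w.IsCycle → 2 * t < w.length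

/-- Good quadruples of positive real numbers. -/
structure IsGoodQuadruple (a b c ε : ℝ) : Prop where
  a_pos : 0 < a
  b_pos : 0 < b
  c_pos : 0 < c
  ε_pos : 0 < ε
  le_a : 2 * c + 1 ≤ a
  le_b : 264 * a ^ 2 / (ε ^ 2 * c ^ 2) ≤ b
  ε_lt : ε < 1 / 10

/-- The colouring `χ` of the edges of `Γ` has a monochromatic copy of `F`. -/
def HasMonochromaticCopy {U V : Type*} {s : ℕ} (F : SimpleGraph U) {Γ : SimpleGraph V}
    (χ : Γ.edgeSet → Fin s) : Prop :=
  ∃ (f : SimpleGraph.Copy F Γ) (i : Fin s), ∀ e : F.edgeSet, χ (f.mapEdgeSet e) = i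

/-- The set of colours used by `χ` on a copy `f` of `F` in `Γ`. -/
def coloursOnCopy {U V : Type*} {s : ℕ} {F : SimpleGraph U} {Γ : SimpleGraph V}
    (χ : Γ.edgeSet → Fin s) (f : SimpleGraph.Copy F Γ) : Set (Fin s) :=
  Set.range fun e : F.edgeSet => χ (f.mapEdgeSet e)

/-! By Ramsey's theorem every clique `C(v)` contains a monochromatic clique `S v` of fixed size.
Keep a majority colour `i` and the set `Vi` of vertices whose clique has it. Call two vertices
linked if `S u` and `S v` contain `2k`-subsets completely joined in colour `i`.

If `Vi` carries a path of `n` links, the `k`-th power of a path can be threaded through the cliques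
in blocks of `2k` vertices, all in colour `i` (`hasMonochromaticCopy_of_chain`). Otherwise
depth-first search yields `t` large disjoint sets `X p` with no link between different ones
(`exists_separated_family`). Pseudorandomness of `G` matches most of one of them into all the others
at once (`exists_simultaneous_matching`), and a random sparsification of `G`, followed by the
removal of vertices of large degree, gives the pseudorandom graph `H` on matched vertices
(`exists_pseudorandom_subgraph`).

The clique of the blow-up over a vertex of `H` consists of its `t` partners, one in each `X p`.
Partners of vertices at distance at most `r` are at distance at most `r + 2` in `G`, which explains
the power of `G`. Since no links cross, edges between the relevant sets `S u` and `S v` are mostly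
present in other colours, and one vertex per clique can be chosen greedily so that every required
edge exists and avoids colour `i` (`exists_representatives`). Nothing is known inside a single `X
p`; the edges needed there are exactly those removed by the shearing. -/

/-! ### Ramsey's theorem -/

/-- Multicolour Ramsey theorem for finite sets, with prescribed clique sizes. -/
theorem exists_ramsey_number {s : ℕ} (f : Fin s → ℕ) :
    ∃ N : ℕ, ∀ (α : Type) (S : Finset α) (κ : α → α → Fin s), (∀ x y, κ x y = κ y x) →
      N ≤ S.card → ∃ i, ∃ A ⊆ S, A.card = f i ∧ ∀ x ∈ A, ∀ y ∈ A, x ≠ y → κ x y = i := by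
  classical
  induction hd : ∑ i, f i using Nat.strong_induction_on generalizing f with
  | _ d ih =>
    by_cases h0 : ∃ i, f i = 0
    · obtain ⟨i, hi⟩ := h0
      exact ⟨0, fun α S κ _ _ => ⟨i, ∅, by simp, by simp [hi], by simp⟩⟩
    · push Not at h0
      have key : ∀ i, ∃ N : ℕ, ∀ (α : Type) (S : Finset α) (κ : α → α → Fin s),
          (∀ x y, κ x y = κ y x) → N ≤ S.card → ∃ j, ∃ A ⊆ S,
            A.card = Function.update f i (f i - 1) j ∧
              ∀ x ∈ A, ∀ y ∈ A, x ≠ y → κ x y = j := by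
        intro i
        refine ih _ ?_ _ rfl
        rw [← hd]
        refine Finset.sum_lt_sum (fun j _ => ?_) ⟨i, Finset.mem_univ _, ?_⟩
        · by_cases hj : j = i
          · subst hj; simp
          · simp [hj]
        · have := h0 i
          simp; omega
      choose N hN using key
      -- Sort the other points by the colour of their edge to `x`. Some class `i` has at least `N i`
      -- points, and there the target for `i` is one smaller because `x` can be added.
      refine ⟨1 + ∑ i, N i, fun α S κ hκ hS => ?_⟩
      obtain ⟨x, hx⟩ : S.Nonempty := Finset.card_pos.1 (by omega)
      have hsum : ∑ i, N i ≤ ∑ i, ((S.erase x).filter fun y => κ x y = i).card := by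
        rw [← Finset.card_eq_sum_card_fiberwise (fun _ _ => Finset.mem_coe.2 (Finset.mem_univ _)),
          Finset.card_erase_of_mem hx]
        omega
      -- `κ x x` serves only to show that some colour exists.
      obtain ⟨i, -, hi⟩ := Finset.exists_le_of_sum_le ⟨κ x x, Finset.mem_univ _⟩ hsum
      obtain ⟨j, A, hAS, hA, hAκ⟩ := hN i α _ κ hκ hi
      have hxA : x ∉ A := fun h => by simpa using hAS h
      by_cases hj : j = i
      · subst hj
        refine ⟨j, insert x A, ?_, ?_, ?_⟩
        · intro y hy
          rcases Finset.mem_insert.1 hy with rfl | hy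
          · exact hx
          · exact Finset.mem_of_mem_erase (Finset.mem_filter.1 (hAS hy)).1
        · rw [Finset.card_insert_of_notMem hxA, hA, Function.update_self]
          have := h0 j
          omega
        · intro y hy z hz hyz
          rcases Finset.mem_insert.1 hy with rfl | hy' <;>
            rcases Finset.mem_insert.1 hz with rfl | hz'
          · exact absurd rfl hyz
          · exact (Finset.mem_filter.1 (hAS hz')).2
          · rw [hκ]; exact (Finset.mem_filter.1 (hAS hy')).2
          · exact hAκ y hy' z hz' hyz
      · refine ⟨j, A, fun y hy => Finset.mem_of_mem_erase (Finset.mem_filter.1 (hAS hy)).1, ?_, hAκ⟩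
        rw [hA, Function.update_of_ne hj]

/-! ### Long paths or separated sets -/

/-- Depth-first search: a set without a long path of the relation `r` contains two large
subsets with no relation between them. -/
theorem exists_separated_pair {α : Type*} (r : α → α → Prop) (hr : ∀ x y, r x y → r y x)
    (S : Finset α) (n M : ℕ) (hS : 2 * M + n ≤ S.card)
    (hpath : ∀ l : List α, l.Nodup → l.IsChain r → (∀ x ∈ l, x ∈ S) → l.length ≠ n) :
    ∃ X ⊆ S, ∃ Y ⊆ S, X.card = M ∧ Y.card = M ∧ Disjoint X Y ∧ ∀ x ∈ X, ∀ y ∈ Y, ¬ r x y := by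
  classical
  -- A search state: `X` is finished, `Y` untouched, and `l` is the current path with its active end
  -- first. Both moves, from `Y` onto the path and from the path into `X`, raise `2|X| + |l|` by
  -- exactly one, so a state of maximal potential admits no move.
  let P : ℕ → Prop := fun q => ∃ (X Y : Finset α) (l : List α), X ⊆ S ∧ Y ⊆ S ∧ Disjoint X Y ∧
    (∀ x ∈ X, ∀ y ∈ Y, ¬ r x y) ∧ l.Nodup ∧ l.IsChain r ∧ (∀ x ∈ l, x ∈ S) ∧
    (∀ x ∈ l, x ∉ X ∧ x ∉ Y) ∧ X.card ≤ Y.card ∧ X.card + Y.card + l.length = S.card ∧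
    2 * X.card + l.length = q
  have h0 : P 0 := ⟨∅, S, [], by simp⟩
  have hb : ∀ q, P q → q ≤ 2 * S.card := by
    rintro q ⟨X, Y, l, -, -, -, -, -, -, -, -, h1, h2, h3⟩
    omega
  have hmax := Nat.findGreatest_spec (P := P) (Nat.zero_le (2 * S.card)) h0
  have hmax' : ¬ P (Nat.findGreatest P (2 * S.card) + 1) := fun h => by
    have := Nat.le_findGreatest (hb _ h) h
    omega
  obtain ⟨X, Y, l, hX, hY, hXY, hr0, hnd, hch, hlS, hlXY, hle, hcard, hq⟩ := hmax
  have hshort : l.length < n := by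
    by_contra hlen
    push Not at hlen
    exact hpath (l.take n) (hnd.sublist (List.take_sublist _ _)) (hch.take n)
      (fun x hx => hlS x (List.mem_of_mem_take hx)) (by simp [hlen])
  rcases hle.lt_or_eq with hlt | heq
  · exfalso
    apply hmax'
    rw [← hq]
    have hmove : ∀ y ∈ Y, (y :: l).IsChain r → P (2 * X.card + l.length + 1) := by
      intro y hy hc
      refine ⟨X, Y.erase y, y :: l, hX, (Finset.erase_subset _ _).trans hY,
        hXY.mono_right (Finset.erase_subset _ _),
        fun x hx z hz => hr0 x hx z (Finset.mem_of_mem_erase hz), ?_, hc, ?_, ?_, ?_, ?_, ?_⟩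
      · exact List.nodup_cons.2 ⟨fun h => (hlXY y h).2 hy, hnd⟩
      · intro x hx
        rcases List.mem_cons.1 hx with rfl | hx
        · exact hY hy
        · exact hlS x hx
      · intro x hx
        rcases List.mem_cons.1 hx with rfl | hx
        · exact ⟨fun h => Finset.disjoint_left.1 hXY h hy, by simp⟩
        · exact ⟨(hlXY x hx).1, fun h => (hlXY x hx).2 (Finset.mem_of_mem_erase h)⟩
      · rw [Finset.card_erase_of_mem hy]; omega
      · rw [Finset.card_erase_of_mem hy, List.length_cons]; omega
      · rw [List.length_cons]; omega
    match l, hmove, hnd, hch, hlS, hlXY, hcard with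
    | [], hmove, _, _, _, _, _ =>
      obtain ⟨y, hy⟩ : Y.Nonempty := Finset.card_pos.1 (by omega)
      exact hmove y hy (List.isChain_singleton y)
    | p :: l', hmove, hnd, hch, hlS, hlXY, hcard =>
      by_cases hp : ∃ y ∈ Y, r y p
      · obtain ⟨y, hy, hyp⟩ := hp
        exact hmove y hy (List.isChain_cons_cons.2 ⟨hyp, hch⟩)
      · push Not at hp
        have hpX := (hlXY p (by simp)).1
        rw [List.nodup_cons] at hnd
        refine ⟨insert p X, Y, l', ?_, hY, ?_, ?_, hnd.2, hch.tail,
          fun x hx => hlS x (by simp [hx]), ?_, ?_, ?_, ?_⟩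
        · exact Finset.insert_subset (hlS p (by simp)) hX
        · exact Finset.disjoint_insert_left.2 ⟨(hlXY p (by simp)).2, hXY⟩
        · intro x hx y hy hxy
          rcases Finset.mem_insert.1 hx with rfl | hx
          · exact hp y hy (hr _ _ hxy)
          · exact hr0 x hx y hy hxy
        · intro x hx
          refine ⟨fun h => ?_, (hlXY x (by simp [hx])).2⟩
          rcases Finset.mem_insert.1 h with rfl | h
          · exact hnd.1 hx
          · exact (hlXY x (by simp [hx])).1 h
        · rw [Finset.card_insert_of_notMem hpX]; omega
        · rw [Finset.card_insert_of_notMem hpX]; simp at hcard; omega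
        · rw [Finset.card_insert_of_notMem hpX]; simp; omega
  -- With `|X| = |Y|` and fewer than `n` vertices on the path, both sets have at least `M` elements.
  · obtain ⟨X', hX', hX'c⟩ := Finset.exists_subset_card_eq (show M ≤ X.card by omega)
    obtain ⟨Y', hY', hY'c⟩ := Finset.exists_subset_card_eq (show M ≤ Y.card by omega)
    exact ⟨X', hX'.trans hX, Y', hY'.trans hY, hX'c, hY'c, hXY.mono hX' hY',
      fun x hx y hy => hr0 x (hX' hx) y (hY' hy)⟩

/-- Iterated form of `exists_separated_pair`: `t` large pairwise separated subsets. -/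
theorem exists_separated_family {α : Type*} (r : α → α → Prop) (hr : ∀ x y, r x y → r y x)
    (n M t : ℕ) (S : Finset α) (hS : 2 ^ t * (M + n) ≤ S.card + n)
    (hpath : ∀ l : List α, l.Nodup → l.IsChain r → (∀ x ∈ l, x ∈ S) → l.length ≠ n) :
    ∃ X : Fin t → Finset α, (∀ i, X i ⊆ S) ∧ (∀ i, (X i).card = M) ∧
      ∀ i j, i ≠ j → Disjoint (X i) (X j) ∧ ∀ x ∈ X i, ∀ y ∈ X j, ¬ r x y := by
  induction t generalizing S with
  | zero => exact ⟨fun _ => ∅, fun i => i.elim0, fun i => i.elim0, fun i => i.elim0⟩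
  | succ t ih =>
    have hpos : M + n ≤ 2 ^ t * (M + n) := Nat.le_mul_of_pos_left _ (by positivity)
    rw [pow_succ] at hS
    -- The bound `2 ^ t * (M + n) - n` reproduces itself: twice it plus `n` is the same expression
    -- for `t + 1`. One half supplies a member of the family, the other is split further.
    obtain ⟨X₀, hX₀, Y, hY, hXc, hYc, hXY, hno⟩ := exists_separated_pair r hr S n
      (2 ^ t * (M + n) - n) (by
        have : 2 ^ t * 2 * (M + n) = 2 * (2 ^ t * (M + n)) := by ring
        omega) hpath
    obtain ⟨X₁, hX₁, hX₁c⟩ := Finset.exists_subset_card_eq (show M ≤ X₀.card by omega)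
    obtain ⟨X, hXS, hXM, hX⟩ := ih Y (by omega)
      (fun l h1 h2 h3 => hpath l h1 h2 fun x hx => hY (h3 x hx))
    refine ⟨Fin.cons X₁ X, ?_, ?_, ?_⟩
    · intro i
      refine Fin.cases ?_ (fun i => ?_) i
      · exact hX₁.trans hX₀
      · exact (hXS i).trans hY
    · intro i
      refine Fin.cases ?_ (fun i => ?_) i
      · exact hX₁c
      · exact hXM i
    · intro i j
      refine Fin.cases (Fin.cases ?_ (fun j => ?_) j) (fun i => Fin.cases ?_ (fun j => ?_) j) i
      · exact fun h => absurd rfl h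
      · intro _
        exact ⟨hXY.mono hX₁ (hXS j), fun x hx y hy => hno x (hX₁ hx) y (hXS j hy)⟩
      · intro _
        exact ⟨(hXY.mono hX₁ (hXS i)).symm,
          fun x hx y hy h => hno y (hX₁ hy) x (hXS i hx) (hr _ _ h)⟩
      · intro hij
        exact hX i j (fun h => hij (congrArg Fin.succ h))

/-! ### Partial matchings and greedy representatives -/

/-- If there is an edge between any two disjoint `m`-sets, all but fewer than `m` vertices of `X`
can be matched into `Y`. -/
theorem exists_partial_matching {V : Type*} (G : SimpleGraph V) (m : ℕ) (X Y : Finset V)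
    (hXY : Disjoint X Y) (hle : X.card ≤ Y.card)
    (hedge : ∀ X' Y' : Finset V, Disjoint X' Y' → X'.card = m → Y'.card = m →
      ∃ x ∈ X', ∃ y ∈ Y', G.Adj x y) :
    ∃ X' ⊆ X, X.card ≤ X'.card + m ∧ ∃ g : V → V, Set.InjOn g X' ∧
      ∀ x ∈ X', g x ∈ Y ∧ G.Adj x (g x) := by
  classical
  let P : ℕ → Prop := fun q => ∃ X' ⊆ X, X'.card = q ∧ ∃ g : V → V, Set.InjOn g X' ∧
    ∀ x ∈ X', g x ∈ Y ∧ G.Adj x (g x)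
  have h0 : P 0 := ⟨∅, by simp, by simp, id, by simp, by simp⟩
  have hmax := Nat.findGreatest_spec (P := P) (Nat.zero_le X.card) h0
  have hmax' : ¬ P (Nat.findGreatest P X.card + 1) := fun h => by
    have : Nat.findGreatest P X.card + 1 ≤ X.card := by
      obtain ⟨X', hX', hc, -⟩ := h
      rw [← hc]; exact Finset.card_le_card hX'
    have := Nat.le_findGreatest this h
    omega
  obtain ⟨X', hX', hq, g, hg, hgY⟩ := hmax
  refine ⟨X', hX', ?_, g, hg, hgY⟩
  -- If a largest matching missed more than `m` vertices of `X`, it would miss as many of `Y`, since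
  -- `|X| ≤ |Y|`, and an edge between the missed parts would enlarge it.
  by_contra hlt
  push Not at hlt
  have hx : m ≤ (X \ X').card := by
    rw [Finset.card_sdiff_of_subset hX']; omega
  have hy : m ≤ (Y \ X'.image g).card := by
    rw [Finset.card_sdiff_of_subset (Finset.image_subset_iff.2 fun x hx => (hgY x hx).1)]
    have := Finset.card_image_le (s := X') (f := g)
    omega
  obtain ⟨X₁, hX₁, hX₁c⟩ := Finset.exists_subset_card_eq hx
  obtain ⟨Y₁, hY₁, hY₁c⟩ := Finset.exists_subset_card_eq hy
  obtain ⟨x, hxX, y, hyY, hxy⟩ := hedge X₁ Y₁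
    (hXY.mono (hX₁.trans Finset.sdiff_subset) (hY₁.trans Finset.sdiff_subset)) hX₁c hY₁c
  obtain ⟨hxX, hxX'⟩ := Finset.mem_sdiff.1 (hX₁ hxX)
  obtain ⟨hyY, hyg⟩ := Finset.mem_sdiff.1 (hY₁ hyY)
  apply hmax'
  have hne : ∀ z ∈ X', z ≠ x := fun z hz h => hxX' (h ▸ hz)
  refine ⟨insert x X', Finset.insert_subset hxX hX', by
    rw [Finset.card_insert_of_notMem hxX', hq], Function.update g x y, ?_, ?_⟩
  · intro z hz w hw hzw
    simp only [Finset.coe_insert, Set.mem_insert_iff, Finset.mem_coe] at hz hw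
    rcases hz with rfl | hz <;> rcases hw with rfl | hw
    · rfl
    · rw [Function.update_self, Function.update_of_ne (hne w hw)] at hzw
      exact absurd (Finset.mem_image.2 ⟨w, hw, hzw.symm⟩) hyg
    · rw [Function.update_self, Function.update_of_ne (hne z hz)] at hzw
      exact absurd (Finset.mem_image.2 ⟨z, hz, hzw⟩) hyg
    · rw [Function.update_of_ne (hne z hz), Function.update_of_ne (hne w hw)] at hzw
      exact hg hz hw hzw
  · intro z hz
    rcases Finset.mem_insert.1 hz with rfl | hz
    · rw [Function.update_self]; exact ⟨hyY, hxy⟩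
    · rw [Function.update_of_ne (hne z hz)]; exact hgY z hz

/-- Greedy choice of representatives `rep v ∈ S v` that are pairwise `good` along a relation
`conf` of bounded degree. -/
theorem exists_representatives {V α : Type*} [Fintype V] (conf : V → V → Prop)
    (hsymm : ∀ u v, conf u v → conf v u) (hirr : ∀ v, ¬ conf v v)
    (D m L : ℕ) (hm : 1 ≤ m)
    (hdeg : ∀ v, ∃ N : Finset V, N.card ≤ D ∧ ∀ u, conf v u → u ∈ N)
    (good : V → V → α → α → Prop) (hgood : ∀ u v a b, good u v a b → good v u b a)
    (S : V → Finset α) (hS : ∀ v, L * (2 * m) ^ D ≤ (S v).card) (hL : D * m + 4 * m + 1 ≤ L)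
    (hbad : ∀ v u, conf v u → ∀ U ⊆ S u, 4 * m ≤ U.card → ∀ A ⊆ S v,
      (∀ a ∈ A, ∀ U' ⊆ U, (∀ b ∈ U', good v u a b) → U'.card * (2 * m) < U.card) → A.card < m) :
    ∃ rep : V → α, (∀ v, rep v ∈ S v) ∧ ∀ u v, conf u v → good u v (rep u) (rep v) := by
  classical
  let S' : (V → α) → Finset V → V → Finset α := fun rep Q u =>
    (S u).filter fun b => ∀ q ∈ Q, conf q u → good q u (rep q) b
  -- Invariant: each processed neighbour of `u` costs a factor of at most `2 * m` among the
  -- candidates for `u`. As there are at most `D` neighbours, at least `L` candidates always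
  -- survive.
  have key : ∀ Q : Finset V, ∃ rep : V → α, (∀ v ∈ Q, rep v ∈ S v) ∧
      (∀ u ∈ Q, ∀ v ∈ Q, conf u v → good u v (rep u) (rep v)) ∧
      ∀ u ∉ Q, L * (2 * m) ^ D ≤ (S' rep Q u).card * (2 * m) ^ (Q.filter fun q => conf q u).card := by
    intro Q
    induction Q using Finset.induction_on with
    | empty =>
      have : ∀ v, ∃ a, a ∈ S v := fun v => by
        have h1 := hS v
        have : 0 < L * (2 * m) ^ D := Nat.mul_pos (by omega) (by positivity)
        exact Finset.card_pos.1 (by omega)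
      choose rep hrep using this
      refine ⟨rep, by simp, by simp, fun u _ => ?_⟩
      simpa [S'] using hS u
    | insert v Q hv ih =>
      obtain ⟨rep, hrep, hrg, hrS⟩ := ih
      have hLS : ∀ u ∉ Q, L ≤ (S' rep Q u).card := by
        intro u hu
        obtain ⟨N, hN, hNu⟩ := hdeg u
        have h1 := hrS u hu
        have h2 : (Q.filter fun q => conf q u).card ≤ D :=
          (Finset.card_le_card fun q hq => hNu q (hsymm _ _ (Finset.mem_filter.1 hq).2)).trans hN
        have h3 : (2 * m) ^ (Q.filter fun q => conf q u).card ≤ (2 * m) ^ D :=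
          Nat.pow_le_pow_right (by omega) h2
        have h4 : 0 < (2 * m) ^ D := by positivity
        exact Nat.le_of_mul_le_mul_right (h1.trans (Nat.mul_le_mul_left _ h3)) h4
      let bad : V → Finset α := fun u => (S' rep Q v).filter fun a =>
        ((S' rep Q u).filter fun b => good v u a b).card * (2 * m) < (S' rep Q u).card
      obtain ⟨N, hN, hNv⟩ := hdeg v
      have hbadc : ∀ u, u ∉ Q → conf v u → (bad u).card < m := by
        intro u hu hvu
        refine hbad v u hvu (S' rep Q u) (Finset.filter_subset _ _) (by have := hLS u hu; omega) _
          ((Finset.filter_subset _ _).trans (Finset.filter_subset _ _)) ?_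
        intro a ha U' hU' hg
        refine lt_of_le_of_lt (Nat.mul_le_mul_right _ (Finset.card_le_card ?_))
          (Finset.mem_filter.1 ha).2
        exact fun b hb => Finset.mem_filter.2 ⟨hU' hb, hg b hb⟩
      -- For each unprocessed neighbour fewer than `m` choices at `v` are harmful, so `D * m < L`
      -- leaves a harmless one.
      have hun : ((N.filter fun u => u ∉ Q ∧ conf v u).biUnion bad).card ≤ D * m := by
        refine (Finset.card_biUnion_le_card_mul _ _ m fun u hu => ?_).trans
          (Nat.mul_le_mul_right _ ((Finset.card_filter_le _ _).trans hN))
        exact (hbadc u (Finset.mem_filter.1 hu).2.1 (Finset.mem_filter.1 hu).2.2).le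
      obtain ⟨a, haS, han⟩ := Finset.exists_mem_notMem_of_card_lt_card
        (lt_of_le_of_lt hun (by have := hLS v hv; omega) : _ < (S' rep Q v).card)
      have hne : ∀ q ∈ Q, q ≠ v := fun q hq h => hv (h ▸ hq)
      have haS' := Finset.mem_filter.1 haS
      refine ⟨Function.update rep v a, ?_, ?_, ?_⟩
      · intro w hw
        rcases Finset.mem_insert.1 hw with rfl | hw
        · rw [Function.update_self]; exact haS'.1
        · rw [Function.update_of_ne (hne w hw)]; exact hrep w hw
      · intro w hw z hz hwz
        rcases Finset.mem_insert.1 hw with rfl | hw' <;>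
          rcases Finset.mem_insert.1 hz with rfl | hz'
        · exact absurd hwz (hirr _)
        · rw [Function.update_self, Function.update_of_ne (hne z hz')]
          exact hgood _ _ _ _ (haS'.2 z hz' (hsymm _ _ hwz))
        · rw [Function.update_self, Function.update_of_ne (hne w hw')]
          exact haS'.2 w hw' hwz
        · rw [Function.update_of_ne (hne z hz'), Function.update_of_ne (hne w hw')]
          exact hrg w hw' z hz' hwz
      · intro u hu
        rw [Finset.mem_insert, not_or] at hu
        have hSeq : S' (Function.update rep v a) (insert v Q) u =
            (S' rep Q u).filter fun b => conf v u → good v u a b := by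
          ext b
          simp only [S', Finset.mem_filter, Finset.mem_insert, forall_eq_or_imp,
            Function.update_self]
          constructor
          · rintro ⟨h1, h2, h3⟩
            exact ⟨⟨h1, fun q hq hqu => by
              have := h3 q hq hqu
              rwa [Function.update_of_ne (hne q hq)] at this⟩, h2⟩
          · rintro ⟨⟨h1, h3⟩, h2⟩
            exact ⟨h1, h2, fun q hq hqu => by
              rw [Function.update_of_ne (hne q hq)]; exact h3 q hq hqu⟩
        have hold := hrS u hu.2
        rw [hSeq, Finset.filter_insert]
        by_cases hvu : conf v u
        · rw [if_pos hvu, Finset.card_insert_of_notMem (by simp [hv]), pow_succ]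
          have hnb : a ∉ bad u := fun h => han
            (Finset.mem_biUnion.2 ⟨u, Finset.mem_filter.2 ⟨hNv u hvu, hu.2, hvu⟩, h⟩)
          have h1 : (S' rep Q u).card ≤
              ((S' rep Q u).filter fun b => good v u a b).card * (2 * m) := by
            by_contra hlt
            exact hnb (Finset.mem_filter.2 ⟨haS, not_le.1 hlt⟩)
          simp only [hvu, true_imp_iff]
          calc _ ≤ _ := hold
            _ ≤ _ := Nat.mul_le_mul_right _ h1
            _ = _ := by ring
        · simpa [hvu] using hold
  obtain ⟨rep, h1, h2, -⟩ := key Finset.univ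
  exact ⟨rep, fun v => h1 v (Finset.mem_univ _),
    fun u v => h2 u (Finset.mem_univ _) v (Finset.mem_univ _)⟩

/-! ### Concentration of random subsets -/

/-- Moment generating function of the size of the intersection of a binomial random subset of `E`
with `F`. -/
theorem sum_binomial_weight_mul_exp_le {α : Type*} [DecidableEq α] (E F : Finset α) (hF : F ⊆ E)
    (p x : ℝ) (hp0 : 0 ≤ p) (hp1 : p ≤ 1) (hx : |x| ≤ 1) :
    ∑ S ∈ E.powerset, p ^ S.card * (1 - p) ^ (E.card - S.card) * Real.exp (x * (S ∩ F).card) ≤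
      Real.exp (p * F.card * (x + x ^ 2)) := by
  have h1 : ∀ S ∈ E.powerset,
      p ^ S.card * (1 - p) ^ (E.card - S.card) * Real.exp (x * (S ∩ F).card) =
        (∏ e ∈ S, p * (if e ∈ F then Real.exp x else 1)) * ∏ _e ∈ E \ S, (1 - p) := by
    intro S hS
    rw [Finset.prod_mul_distrib, Finset.prod_const, Finset.prod_const,
      Finset.card_sdiff_of_subset (Finset.mem_powerset.1 hS), Finset.prod_ite_mem,
      Finset.prod_const, ← Real.exp_nat_mul]
    ring_nf
  -- The sum over subsets factors into one term per element; each is then bounded by `exp x ≤ 1 + x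
  -- + x ^ 2` for `|x| ≤ 1`.
  rw [Finset.sum_congr rfl h1, ← Finset.prod_add]
  have h2 : ∀ e ∈ E, p * (if e ∈ F then Real.exp x else 1) + (1 - p) =
      if e ∈ F then p * Real.exp x + (1 - p) else 1 := by
    intro e _
    split_ifs <;> ring
  rw [Finset.prod_congr rfl h2, Finset.prod_ite_mem, Finset.inter_eq_right.2 hF,
    Finset.prod_const]
  have h3 := (abs_le.1 (Real.abs_exp_sub_one_sub_id_le hx)).2
  have h4 : p * Real.exp x + (1 - p) ≤ Real.exp (p * (x + x ^ 2)) := by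
    have := Real.add_one_le_exp (p * (x + x ^ 2))
    nlinarith
  have hnn : 0 ≤ p * Real.exp x + (1 - p) :=
    add_nonneg (mul_nonneg hp0 (Real.exp_nonneg _)) (by linarith)
  calc _ ≤ (Real.exp (p * (x + x ^ 2))) ^ F.card := pow_le_pow_left₀ hnn h4 _
    _ = _ := by rw [← Real.exp_nat_mul]; ring_nf

/-- A random subset with density `p` meets every member of a not too large family of sets of
almost equal sizes in about the expected number of elements. -/
theorem exists_sample {α ι : Type*} [DecidableEq α] (E : Finset α) (J : Finset ι)
    (F : ι → Finset α) (hF : ∀ j ∈ J, F j ⊆ E) (p M ε : ℝ) (hp0 : 0 ≤ p) (hp1 : p ≤ 1)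
    (hM : 0 ≤ M) (hε0 : 0 < ε) (hε1 : ε ≤ 1 / 2)
    (hlo : ∀ j ∈ J, (1 - ε / 8) * M ≤ (F j).card) (hhi : ∀ j ∈ J, (F j).card ≤ (1 + ε / 8) * M)
    (hJ : 2 * J.card * Real.exp (-(ε ^ 2 * (p * M) / 6)) < 1) :
    ∃ S ⊆ E, ∀ j ∈ J, (1 - ε) * (p * M) ≤ (S ∩ F j).card ∧
      ((S ∩ F j).card : ℝ) ≤ (1 + ε) * (p * M) := by
  by_contra! hcon
  have hw : ∀ S : Finset α, 0 ≤ p ^ S.card * (1 - p) ^ (E.card - S.card) := fun S =>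
    mul_nonneg (pow_nonneg hp0 _) (pow_nonneg (by linarith) _)
  have hpM : 0 ≤ p * M := mul_nonneg hp0 hM
  -- Chernoff tilt: the slack `ε / 8` in the sizes and `ε ≤ 1 / 2` leave both tail exponents below
  -- `-ε ^ 2 * (p * M) / 6`.
  set u : ℝ := ε / 2 with hu
  have hone : ∑ S ∈ E.powerset, p ^ S.card * (1 - p) ^ (E.card - S.card) = 1 := by
    rw [Finset.sum_pow_mul_eq_add_pow]; simp
  -- Union bound with exponential Markov: if every `S` failed for some `j`, the total weight 1 would
  -- be at most the sum of all tail bounds.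
  have hpt : ∀ S ∈ E.powerset, p ^ S.card * (1 - p) ^ (E.card - S.card) ≤
      ∑ j ∈ J, (p ^ S.card * (1 - p) ^ (E.card - S.card) * Real.exp (u * (S ∩ F j).card) *
          Real.exp (-(u * ((1 + ε) * (p * M)))) +
        p ^ S.card * (1 - p) ^ (E.card - S.card) * Real.exp (-u * (S ∩ F j).card) *
          Real.exp (u * ((1 - ε) * (p * M)))) := by
    intro S hS
    obtain ⟨j, hj, hjS⟩ := hcon S (Finset.mem_powerset.1 hS)
    refine le_trans ?_ (Finset.single_le_sum (fun i _ => ?_) hj)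
    · rw [mul_assoc, mul_assoc _ (Real.exp _) (Real.exp _), ← Real.exp_add, ← Real.exp_add,
        ← mul_add]
      refine le_mul_of_one_le_right (hw S) ?_
      by_cases h : (1 - ε) * (p * M) ≤ (S ∩ F j).card
      · have h1 : 1 ≤ Real.exp (u * (S ∩ F j).card + -(u * ((1 + ε) * (p * M)))) :=
          Real.one_le_exp (by nlinarith [hjS h])
        linarith [Real.exp_nonneg (-u * (S ∩ F j).card + u * ((1 - ε) * (p * M)))]
      · have h1 : 1 ≤ Real.exp (-u * (S ∩ F j).card + u * ((1 - ε) * (p * M))) :=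
          Real.one_le_exp (by nlinarith)
        linarith [Real.exp_nonneg (u * (S ∩ F j).card + -(u * ((1 + ε) * (p * M))))]
    · have := hw S
      positivity
  have hle := Finset.sum_le_sum hpt
  rw [hone, Finset.sum_comm] at hle
  have hj : ∀ j ∈ J, ∑ S ∈ E.powerset,
      (p ^ S.card * (1 - p) ^ (E.card - S.card) * Real.exp (u * (S ∩ F j).card) *
          Real.exp (-(u * ((1 + ε) * (p * M)))) +
        p ^ S.card * (1 - p) ^ (E.card - S.card) * Real.exp (-u * (S ∩ F j).card) *
          Real.exp (u * ((1 - ε) * (p * M)))) ≤ 2 * Real.exp (-(ε ^ 2 * (p * M) / 6)) := by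
    intro j hj
    rw [Finset.sum_add_distrib, ← Finset.sum_mul, ← Finset.sum_mul, two_mul]
    have hua : |u| ≤ 1 := abs_le.2 ⟨by linarith, by linarith⟩
    have b1 := sum_binomial_weight_mul_exp_le E (F j) (hF j hj) p u hp0 hp1 hua
    have b2 := sum_binomial_weight_mul_exp_le E (F j) (hF j hj) p (-u) hp0 hp1 (by rwa [abs_neg])
    have c1 : p * (F j).card ≤ (1 + ε / 8) * (p * M) := by nlinarith [hhi j hj]
    have c2 : (1 - ε / 8) * (p * M) ≤ p * (F j).card := by nlinarith [hlo j hj]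
    refine add_le_add ?_ ?_
    · refine (mul_le_mul_of_nonneg_right b1 (Real.exp_nonneg _)).trans ?_
      rw [← Real.exp_add]
      refine Real.exp_le_exp.2 ?_
      have : p * (F j).card * (u + u ^ 2) ≤ (1 + ε / 8) * (p * M) * (u + u ^ 2) :=
        mul_le_mul_of_nonneg_right c1 (by positivity)
      have h3 : (1 + ε / 8) * (u + u ^ 2) - u * (1 + ε) + ε ^ 2 / 6 ≤ 0 := by
        rw [hu]; nlinarith [mul_nonneg (mul_nonneg hε0.le hε0.le) (sub_nonneg.2 hε1)]
      nlinarith [mul_nonneg hpM (neg_nonneg.2 h3)]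
    · refine (mul_le_mul_of_nonneg_right b2 (Real.exp_nonneg _)).trans ?_
      rw [← Real.exp_add]
      refine Real.exp_le_exp.2 ?_
      have : (1 - ε / 8) * (p * M) * (u - u ^ 2) ≤ p * (F j).card * (u - u ^ 2) :=
        mul_le_mul_of_nonneg_right c2 (by rw [hu]; nlinarith)
      have h3 : -((1 - ε / 8) * (u - u ^ 2)) + u * (1 - ε) + ε ^ 2 / 6 ≤ 0 := by
        rw [hu]; nlinarith [mul_nonneg hε0.le hε0.le, mul_nonneg (mul_nonneg hε0.le hε0.le) hε0.le]
      nlinarith [mul_nonneg hpM (neg_nonneg.2 h3)]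
  have := hle.trans (Finset.sum_le_sum hj)
  rw [Finset.sum_const, nsmul_eq_mul] at this
  linarith

/-! ### Averaging, balanced cuts and small degrees -/

/-- Averaging over the deletion of one element carries a bound on the mean from `q`-sets to `(q +
1)`-sets. -/
theorem sum_le_card_mul_of_forall_card_eq {V : Type*} (g : V → ℝ) (U : Finset V)
    (m : ℕ) (hm : 1 ≤ m) (D : ℝ) (h : ∀ X ⊆ U, X.card = m → ∑ x ∈ X, g x ≤ m * D)
    (X : Finset V) (hX : X ⊆ U) (hmX : m ≤ X.card) : ∑ x ∈ X, g x ≤ X.card * D := by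
  classical
  obtain ⟨q, hq⟩ : ∃ q, X.card = q := ⟨_, rfl⟩
  rw [hq] at hmX
  induction q, hmX using Nat.le_induction generalizing X with
  | base => rw [hq]; exact h X hX hq
  | succ q hmq ih =>
    have h1 : ∀ x ∈ X, ∑ y ∈ X, g y - g x ≤ q * D := by
      intro x hx
      have hc : (X.erase x).card = q := by rw [Finset.card_erase_of_mem hx, hq]; rfl
      have := ih (X.erase x) ((Finset.erase_subset _ _).trans hX) hc
      rw [hc] at this
      rw [← Finset.add_sum_erase X g hx]
      linarith
    have h2 := Finset.sum_le_sum h1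
    rw [Finset.sum_sub_distrib, Finset.sum_const, Finset.sum_const, hq, nsmul_eq_mul,
      nsmul_eq_mul] at h2
    push_cast at h2
    rw [hq]
    push_cast
    have hq0 : (0 : ℝ) < q := by exact_mod_cast (by omega : 0 < q)
    nlinarith

/-- One-variable averaging in each coordinate in turn. It extends a density bound from pairs of
`m`-sets to pairs of larger sets. -/
theorem sum_sum_le_card_mul_card {V : Type*} (w : V → V → ℝ) (U : Finset V)
    (m : ℕ) (hm : 1 ≤ m) (D : ℝ)
    (h : ∀ X ⊆ U, ∀ Y ⊆ U, Disjoint X Y → X.card = m → Y.card = m →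
      ∑ x ∈ X, ∑ y ∈ Y, w x y ≤ m * (m * D))
    (X Y : Finset V) (hX : X ⊆ U) (hY : Y ⊆ U) (hXY : Disjoint X Y) (hmX : m ≤ X.card)
    (hmY : m ≤ Y.card) : ∑ x ∈ X, ∑ y ∈ Y, w x y ≤ X.card * (Y.card * D) := by
  rw [Finset.sum_comm]
  have key : ∀ Y' ⊆ Y, Y'.card = m → ∑ y ∈ Y', ∑ x ∈ X, w x y ≤ m * (X.card * D) := by
    intro Y' hY' hc
    rw [Finset.sum_comm]
    have := sum_le_card_mul_of_forall_card_eq (fun x => ∑ y ∈ Y', w x y) X m hm (m * D)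
      (fun X' hX' hc' => h X' (hX'.trans hX) Y' (hY'.trans hY) (hXY.mono hX' hY') hc' hc) X
      subset_rfl hmX
    linarith
  have := sum_le_card_mul_of_forall_card_eq (fun y => ∑ x ∈ X, w x y) Y m hm (X.card * D) key Y
    subset_rfl hmY
  linarith

/-- Every set of even size has a balanced bipartition that cuts at least half of the weight. -/
theorem exists_balanced_cut {V : Type*} [DecidableEq V] (w : V → V → ℝ)
    (hsymm : ∀ x y, w x y = w y x) (hdiag : ∀ x, w x x = 0) (hw : ∀ x y, 0 ≤ w x y)
    (h : ℕ) (Z : Finset V) (hZ : Z.card = 2 * h) :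
    ∃ X Y : Finset V, Disjoint X Y ∧ X ∪ Y = Z ∧ X.card = h ∧ Y.card = h ∧
      ∑ x ∈ Z, ∑ y ∈ Z, w x y ≤ 4 * ∑ x ∈ X, ∑ y ∈ Y, w x y := by
  induction h generalizing Z with
  | zero =>
    have : Z = ∅ := Finset.card_eq_zero.1 (by omega)
    subst this
    exact ⟨∅, ∅, by simp⟩
  | succ h ih =>
    obtain ⟨u, hu⟩ : Z.Nonempty := Finset.card_pos.1 (by omega)
    obtain ⟨v, hv⟩ : (Z.erase u).Nonempty :=
      Finset.card_pos.1 (by rw [Finset.card_erase_of_mem hu]; omega)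
    obtain ⟨X, Y, hXY, hZ', hXc, hYc, hcut⟩ := ih ((Z.erase u).erase v) (by
      rw [Finset.card_erase_of_mem hv, Finset.card_erase_of_mem hu]; omega)
    have huv : u ≠ v := fun h => by simp [h] at hv
    have hZeq : Z = insert u (insert v (X ∪ Y)) := by
      rw [hZ', Finset.insert_erase hv, Finset.insert_erase hu]
    have huXY : u ∉ X ∪ Y := by rw [hZ']; simp
    have hvXY : v ∉ X ∪ Y := by rw [hZ']; simp
    rw [← hZ'] at hcut
    simp only [Finset.mem_union, not_or] at huXY hvXY
    have hu2 : u ∉ insert v (X ∪ Y) := by simp [huv, huXY]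
    have hv2 : v ∉ X ∪ Y := by simp [hvXY]
    have hs : ∀ a, ∑ x ∈ X, w x a = ∑ x ∈ X, w a x :=
      fun a => Finset.sum_congr rfl fun x _ => hsymm _ _
    have hs' : ∀ a, ∑ x ∈ Y, w x a = ∑ x ∈ Y, w a x :=
      fun a => Finset.sum_congr rfl fun x _ => hsymm _ _
    have htot : ∑ x ∈ Z, ∑ y ∈ Z, w x y = ∑ x ∈ X ∪ Y, ∑ y ∈ X ∪ Y, w x y +
        2 * (∑ x ∈ X, w u x + ∑ x ∈ Y, w u x + ∑ x ∈ X, w v x + ∑ x ∈ Y, w v x + w u v) := by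
      rw [hZeq]
      simp only [Finset.sum_insert hu2, Finset.sum_insert hv2, Finset.sum_add_distrib, hdiag]
      simp only [Finset.sum_union hXY, Finset.sum_add_distrib, hs, hs', hsymm v u]
      ring
    have c1 : ∑ x ∈ insert u X, ∑ y ∈ insert v Y, w x y = ∑ x ∈ X, ∑ y ∈ Y, w x y +
        (∑ x ∈ Y, w u x + ∑ x ∈ X, w v x + w u v) := by
      simp only [Finset.sum_insert huXY.1, Finset.sum_insert hvXY.2, Finset.sum_add_distrib, hs]
      ring
    have c2 : ∑ x ∈ insert v X, ∑ y ∈ insert u Y, w x y = ∑ x ∈ X, ∑ y ∈ Y, w x y +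
        (∑ x ∈ X, w u x + ∑ x ∈ Y, w v x + w u v) := by
      simp only [Finset.sum_insert hvXY.1, Finset.sum_insert huXY.2, Finset.sum_add_distrib, hs,
        hsymm v u]
      ring
    have hw0 := hw u v
    -- The two ways of placing `u` and `v` on opposite sides together cut all their weight to `X ∪
    -- Y`, and `w u v` twice, so the better one cuts at least half. The sum over `Z` counts ordered
    -- pairs, hence the factor 4.
    by_cases hc : ∑ x ∈ X, w u x + ∑ x ∈ Y, w v x ≤ ∑ x ∈ Y, w u x + ∑ x ∈ X, w v x
    · refine ⟨insert u X, insert v Y, ?_, ?_, ?_, ?_, ?_⟩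
      · simp [huv.symm, huXY, hvXY, hXY]
      · rw [hZeq]; ext; simp; tauto
      · rw [Finset.card_insert_of_notMem huXY.1, hXc]
      · rw [Finset.card_insert_of_notMem hvXY.2, hYc]
      · rw [htot, c1]; linarith
    · refine ⟨insert v X, insert u Y, ?_, ?_, ?_, ?_, ?_⟩
      · simp [huv, huXY, hvXY, hXY]
      · rw [hZeq]; ext; simp
      · rw [Finset.card_insert_of_notMem hvXY.1, hXc]
      · rw [Finset.card_insert_of_notMem huXY.2, hYc]
      · rw [htot, c2]; linarith

open Classical in
theorem card_interedges_eq_sum {V : Type*} (G : SimpleGraph V) (X Y : Finset V) :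
    ((G.interedges X Y).card : ℝ) = ∑ x ∈ X, ∑ y ∈ Y, if G.Adj x y then (1 : ℝ) else 0 := by
  rw [SimpleGraph.interedges_def, Finset.card_filter, Finset.sum_product]
  push_cast
  rfl

open Classical in
/-- Half of the vertices have small degree. -/
theorem exists_half_small_degree {V : Type*} (H : SimpleGraph V) (U : Finset V) (h m : ℕ)
    (hU : U.card = 2 * h) (hm : 1 ≤ m) (hmh : m ≤ h) (D b : ℝ) (hb : 0 < b)
    (hD : ∀ X ⊆ U, ∀ Y ⊆ U, Disjoint X Y → X.card = m → Y.card = m →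
      ((H.interedges X Y).card : ℝ) ≤ m * (m * D)) (hDb : 4 * D * h ≤ b) :
    ∃ W ⊆ U, W.card = h ∧ ∀ v ∈ W, ((U.filter fun u => H.Adj v u).card : ℝ) ≤ b := by
  set w : V → V → ℝ := fun x y => if H.Adj x y then 1 else 0 with hwdef
  obtain ⟨X, Y, hXY, hXYU, hXc, hYc, hcut⟩ := exists_balanced_cut w
    (fun x y => by simp [hwdef, H.adj_comm]) (fun x => by simp [hwdef])
    (fun x y => by simp only [hwdef]; split_ifs <;> norm_num) h U hU
  have h1 := sum_sum_le_card_mul_card w U m hm D (fun X' hX' Y' hY' hd hx hy => by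
    rw [← card_interedges_eq_sum]; exact hD X' hX' Y' hY' hd hx hy) X Y
    (hXYU ▸ Finset.subset_union_left) (hXYU ▸ Finset.subset_union_right) hXY (by omega) (by omega)
  rw [hXc, hYc] at h1
  have hdeg : ∀ v, ((U.filter fun u => H.Adj v u).card : ℝ) = ∑ y ∈ U, w v y := by
    intro v
    rw [Finset.card_filter]; push_cast; rfl
  set Z := U.filter fun v => b < (U.filter fun u => H.Adj v u).card with hZ
  have hZU : Z ⊆ U := Finset.filter_subset _ _
  -- More than `h` vertices of degree above `b` would force total degree at least `(h + 1) * b`,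
  -- while the cut bounds it by `4 * D * h ^ 2 ≤ b * h`.
  have hZc : Z.card ≤ h := by
    by_contra hlt
    push Not at hlt
    have h2 : Z.card * b ≤ ∑ x ∈ U, ∑ y ∈ U, w x y := by
      calc Z.card * b = ∑ x ∈ Z, b := by rw [Finset.sum_const, nsmul_eq_mul]
        _ ≤ ∑ x ∈ Z, ∑ y ∈ U, w x y := Finset.sum_le_sum fun x hx => by
          rw [← hdeg]; exact (Finset.mem_filter.1 hx).2.le
        _ ≤ _ := Finset.sum_le_sum_of_subset_of_nonneg (Finset.filter_subset _ _)
          fun x _ _ => by rw [← hdeg]; positivity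
    have h3 : ((h : ℝ) + 1) * b ≤ Z.card * b :=
      mul_le_mul_of_nonneg_right (by exact_mod_cast hlt) hb.le
    have h4 : (4 * D * h) * h ≤ b * h := mul_le_mul_of_nonneg_right hDb (by positivity)
    nlinarith
  obtain ⟨W, hW, hWc⟩ := Finset.exists_subset_card_eq (show h ≤ (U \ Z).card by
    rw [Finset.card_sdiff_of_subset hZU]; omega)
  refine ⟨W, hW.trans Finset.sdiff_subset, hWc, fun v hv => ?_⟩
  have := Finset.mem_sdiff.1 (hW hv)
  by_contra hlt
  exact this.2 (Finset.mem_filter.2 ⟨this.1, not_le.1 hlt⟩)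

/-! ### Random sparsification -/

open Classical in
/-- Random sparsification of a graph whose edges are evenly distributed. -/
theorem exists_sparse_subgraph {V : Type*} [Fintype V] (G : SimpleGraph V) (U : Finset V)
    (hU : U.Nonempty) (m : ℕ) (hm : 1 ≤ m) (ε f : ℝ) (hε0 : 0 < ε) (hε1 : ε ≤ 1 / 2) (hf : 0 < f)
    (hG : ∀ X ⊆ U, ∀ Y ⊆ U, Disjoint X Y → X.card = m → Y.card = m →
      (1 - ε / 8) * (m * (m * f)) ≤ (G.interedges X Y).card ∧
      ((G.interedges X Y).card : ℝ) ≤ (1 + ε / 8) * (m * (m * f))) :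
    ∃ H ≤ G, ∃ f' : ℝ, 0 < f' ∧ ε ^ 2 * (m * (m * f')) ≤ 24 * U.card ∧
      ∀ X ⊆ U, ∀ Y ⊆ U, Disjoint X Y → X.card = m → Y.card = m →
        (1 - ε) * (m * (m * f')) ≤ (H.interedges X Y).card ∧
        ((H.interedges X Y).card : ℝ) ≤ (1 + ε) * (m * (m * f')) := by
  have hm0 : (0 : ℝ) < m := by exact_mod_cast hm
  have hU0 : (0 : ℝ) < U.card := by exact_mod_cast hU.card_pos
  have hmf : 0 < m * (m * f) := by positivity
  by_cases hsmall : ε ^ 2 * (m * (m * f)) ≤ 24 * U.card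
  · refine ⟨G, le_rfl, f, hf, hsmall, fun X hX Y hY hd hx hy => ?_⟩
    obtain ⟨h1, h2⟩ := hG X hX Y hY hd hx hy
    constructor <;> nlinarith
  push Not at hsmall
  -- This `p` makes each pair `(X, Y)` fail with probability at most `2 * exp (-4 * |U|)`, which
  -- beats the at most `4 ^ |U|` pairs.
  set p : ℝ := 24 * U.card / (ε ^ 2 * (m * (m * f))) with hp
  have hp0 : 0 < p := by positivity
  have hp1 : p ≤ 1 := (div_le_one (by positivity)).2 hsmall.le
  have hpM : ε ^ 2 * (p * (m * (m * f))) = 24 * U.card := by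
    rw [hp]; field_simp
  let J := (U.powerset ×ˢ U.powerset).filter fun q =>
    Disjoint q.1 q.2 ∧ q.1.card = m ∧ q.2.card = m
  let F : Finset V × Finset V → Finset (Sym2 V) := fun q =>
    (G.interedges q.1 q.2).image fun e => s(e.1, e.2)
  have hinj : ∀ X Y : Finset V, Disjoint X Y →
      Set.InjOn (fun e : V × V => s(e.1, e.2)) (X ×ˢ Y : Finset (V × V)) := by
    rintro X Y hd ⟨x, y⟩ he ⟨x', y'⟩ he' heq
    simp only [Finset.coe_product, Set.mem_prod, Finset.mem_coe] at he he'
    rcases Sym2.eq_iff.1 heq with ⟨rfl, rfl⟩ | ⟨h1, h2⟩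
    · rfl
    · simp only at h1 h2
      exact absurd he'.2 (h1 ▸ Finset.disjoint_left.1 hd he.1)
  have hsub : ∀ (K : SimpleGraph V) (X Y : Finset V),
      ((K.interedges X Y : Finset (V × V)) : Set (V × V)) ⊆ (X ×ˢ Y : Finset (V × V)) :=
    fun K X Y => Finset.coe_subset.2 (Finset.filter_subset _ _)
  have hFc : ∀ q ∈ J, (F q).card = (G.interedges q.1 q.2).card := fun q hq =>
    Finset.card_image_of_injOn ((hinj q.1 q.2 (Finset.mem_filter.1 hq).2.1).mono (hsub _ _ _))
  have hJG : ∀ q ∈ J, (1 - ε / 8) * (m * (m * f)) ≤ (F q).card ∧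
      ((F q).card : ℝ) ≤ (1 + ε / 8) * (m * (m * f)) := by
    intro q hq
    rw [hFc q hq]
    obtain ⟨h1, h2, h3, h4⟩ := Finset.mem_filter.1 hq
    rw [Finset.mem_product, Finset.mem_powerset, Finset.mem_powerset] at h1
    exact hG q.1 h1.1 q.2 h1.2 h2 h3 h4
  have hJc : 2 * (J.card : ℝ) * Real.exp (-(ε ^ 2 * (p * (m * (m * f))) / 6)) < 1 := by
    have h1 : (J.card : ℝ) ≤ 4 ^ U.card := by
      have : J.card ≤ 2 ^ U.card * 2 ^ U.card := by
        refine (Finset.card_filter_le _ _).trans ?_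
        rw [Finset.card_product, Finset.card_powerset]
      rw [← mul_pow] at this
      exact_mod_cast this
    have h2 : Real.exp (-(ε ^ 2 * (p * (m * (m * f))) / 6)) ≤ (1 / 16) ^ U.card := by
      rw [hpM, show -(24 * (U.card : ℝ) / 6) = U.card * (-4) by ring, Real.exp_nat_mul]
      refine pow_le_pow_left₀ (Real.exp_nonneg _) ?_ _
      rw [Real.exp_neg, one_div]
      refine inv_anti₀ (by norm_num) ?_
      have h3 : (2 : ℝ) ≤ Real.exp 1 := by linarith [Real.add_one_le_exp (1 : ℝ)]
      calc (16 : ℝ) = 2 ^ 4 := by norm_num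
        _ ≤ Real.exp 1 ^ 4 := pow_le_pow_left₀ (by norm_num) h3 4
        _ = Real.exp 4 := by rw [← Real.exp_nat_mul]; norm_num
    have h3 : ((1 : ℝ) / 4) ^ U.card ≤ (1 / 4) ^ 1 :=
      pow_le_pow_of_le_one (by norm_num) (by norm_num) hU.card_pos
    calc _ ≤ 2 * (4 : ℝ) ^ U.card * (1 / 16) ^ U.card := by gcongr
      _ = 2 * (1 / 4) ^ U.card := by rw [mul_assoc, ← mul_pow]; norm_num
      _ < 1 := by linarith
  obtain ⟨S, hSE, hS⟩ := exists_sample G.edgeFinset J F (fun q _ e he => by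
      obtain ⟨⟨x, y⟩, hxy, rfl⟩ := Finset.mem_image.1 he
      rw [SimpleGraph.mem_edgeFinset]
      exact ((SimpleGraph.mk_mem_interedges_iff G).1 hxy).2.2) p (m * (m * f)) ε hp0.le hp1 hmf.le
    hε0 hε1 (fun q hq => (hJG q hq).1) (fun q hq => (hJG q hq).2) hJc
  have hSG : ∀ x y, s(x, y) ∈ S → G.Adj x y := fun x y h => by
    have := hSE h
    rwa [SimpleGraph.mem_edgeFinset] at this
  obtain ⟨H, hadj⟩ : ∃ H : SimpleGraph V, ∀ x y, H.Adj x y ↔ s(x, y) ∈ S := by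
    refine ⟨SimpleGraph.fromEdgeSet (S : Set (Sym2 V)), fun x y => ?_⟩
    rw [SimpleGraph.fromEdgeSet_adj]
    exact ⟨fun h => h.1, fun h => ⟨h, (hSG x y h).ne⟩⟩
  refine ⟨H, fun x y h => hSG x y ((hadj x y).1 h),
    p * f, by positivity, ?_, ?_⟩
  · rw [← hpM]; exact le_of_eq (by ring)
  · intro X hX Y hY hd hx hy
    have hq : (X, Y) ∈ J := by simp [J, hX, hY, hd, hx, hy]
    have hcard : (S ∩ F (X, Y)).card = (H.interedges X Y).card := by
      rw [← Finset.card_image_of_injOn ((hinj X Y hd).mono (hsub H X Y))]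
      congr 1
      ext e
      simp only [F, Finset.mem_inter, Finset.mem_image, Prod.exists,
        SimpleGraph.mk_mem_interedges_iff, hadj]
      constructor
      · rintro ⟨he, x, y, ⟨h1, h2, -⟩, rfl⟩
        exact ⟨x, y, ⟨h1, h2, he⟩, rfl⟩
      · rintro ⟨x, y, ⟨h1, h2, h3⟩, rfl⟩
        exact ⟨h3, x, y, ⟨h1, h2, hSG _ _ h3⟩, rfl⟩
    have := hS _ hq
    rw [hcard] at this
    rw [show (m : ℝ) * (m * (p * f)) = p * (m * (m * f)) by ring]
    exact this

/-! ### Distances and balls -/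

theorem edist_le_iff_exists_walk {V : Type*} (G : SimpleGraph V) (u v : V) (R : ℕ) :
    G.edist u v ≤ R ↔ ∃ p : G.Walk u v, p.length ≤ R := by
  constructor
  · intro h
    obtain ⟨p, hp⟩ := G.exists_walk_of_edist_ne_top
      (ne_top_of_le_ne_top (ENat.natCast_ne_top R) h)
    exact ⟨p, by rw [← hp] at h; exact_mod_cast h⟩
  · rintro ⟨p, hp⟩
    exact (G.edist_le p).trans (by exact_mod_cast hp)

theorem edist_map_le {V W : Type*} {G : SimpleGraph V} {H : SimpleGraph W} (φ : H →g G) {u v : W}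
    {R : ℕ} (h : H.edist u v ≤ R) : G.edist (φ u) (φ v) ≤ R := by
  obtain ⟨p, hp⟩ := (edist_le_iff_exists_walk H u v R).1 h
  exact (edist_le_iff_exists_walk G _ _ R).2 ⟨p.map φ, by rwa [SimpleGraph.Walk.length_map]⟩

theorem exists_finset_edist_le {V : Type*} [Fintype V] (G : SimpleGraph V) [DecidableRel G.Adj]
    (D : ℕ) (hD : ∀ v, (G.neighborFinset v).card ≤ D) (R : ℕ) (v : V) :
    ∃ N : Finset V, N.card ≤ (D + 1) ^ R ∧ ∀ u, G.edist v u ≤ R → u ∈ N := by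
  classical
  induction R with
  | zero => exact ⟨{v}, by simp, fun u hu => by
      rw [Nat.cast_zero, nonpos_iff_eq_zero, SimpleGraph.edist_eq_zero_iff] at hu
      simp [hu]⟩
  | succ R ih =>
    obtain ⟨N, hN, hNv⟩ := ih
    refine ⟨N.biUnion fun y => insert y (G.neighborFinset y), ?_, fun u hu => ?_⟩
    · rw [pow_succ]
      exact (Finset.card_biUnion_le_card_mul _ _ (D + 1) fun y _ =>
        (Finset.card_insert_le _ _).trans (Nat.succ_le_succ (hD y))).trans
          (Nat.mul_le_mul_right _ hN)
    · rw [SimpleGraph.edist_comm, edist_le_iff_exists_walk] at hu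
      obtain ⟨p, hp⟩ := hu
      cases p with
      | nil => exact Finset.mem_biUnion.2 ⟨v, hNv v (by simp), by simp⟩
      | @cons _ y _ h q =>
        refine Finset.mem_biUnion.2 ⟨y, hNv y ?_, by simp [h.symm]⟩
        rw [SimpleGraph.edist_comm, edist_le_iff_exists_walk]
        exact ⟨q, by simpa using hp⟩

theorem pathGraph_walk_length {n : ℕ} {p q : Fin n} (w : (SimpleGraph.pathGraph n).Walk p q) :
    (p : ℕ) ≤ q + w.length ∧ (q : ℕ) ≤ p + w.length := by
  induction w with
  | nil => simp
  | cons h w ih =>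
    rw [SimpleGraph.pathGraph_adj] at h
    rw [SimpleGraph.Walk.length_cons]
    omega

/-! ### Powers of paths from chains of cliques -/

/-- Orders one block of the path power: the `k` slots in `I` face the previous clique, those in `O`
the next one. Arguments from `2 * k` on carry no information. -/
theorem exists_enumeration {α : Type*} [LinearOrder α] (k : ℕ) (hk : 1 ≤ k) (I O : Finset α)
    (hdisj : Disjoint I O) (hI : I.card = k) (hO : O.card = k) :
    ∃ e : ℕ → α, (∀ x < k, e x ∈ I) ∧ (∀ x, k ≤ x → x < 2 * k → e x ∈ O) ∧
      ∀ x < 2 * k, ∀ y < 2 * k, e x = e y → x = y := by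
  have hk' : ∀ x, (if x < k then x else 0) < k := fun x => by split_ifs <;> omega
  have hk'' : ∀ x, (if x - k < k then x - k else 0) < k := fun x => by split_ifs <;> omega
  let e : ℕ → α := fun x => if x < k then I.orderEmbOfFin hI ⟨_, hk' x⟩ else
    O.orderEmbOfFin hO ⟨_, hk'' x⟩
  have h1 : ∀ x < k, e x ∈ I := fun x hx => by
    simp only [e, if_pos hx]; exact Finset.orderEmbOfFin_mem _ _ _
  have h2 : ∀ x, k ≤ x → x < 2 * k → e x ∈ O := fun x hx _ => by
    simp only [e, if_neg (not_lt.2 hx)]; exact Finset.orderEmbOfFin_mem _ _ _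
  refine ⟨e, h1, h2, fun x hx y hy hxy => ?_⟩
  rcases lt_or_ge x k with hxk | hxk <;> rcases lt_or_ge y k with hyk | hyk
  · simp only [e, if_pos hxk, if_pos hyk] at hxy
    simpa using hxy
  · exact absurd (hxy ▸ h2 y hyk hy) (Finset.disjoint_left.1 hdisj (h1 x hxk))
  · exact absurd (hxy ▸ h2 x hxk hx) (Finset.disjoint_left.1 hdisj (h1 y hyk))
  · simp only [e, if_neg (not_lt.2 hxk), if_neg (not_lt.2 hyk)] at hxy
    have h3 : x - k < k := by omega
    have h4 : y - k < k := by omega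
    have h5 := congrArg Fin.val ((O.orderEmbOfFin hO).injective hxy)
    simp only [if_pos h3, if_pos h4] at h5
    omega

/-- A chain of monochromatic cliques joined by large complete bipartite graphs of the same colour
contains a monochromatic power of a path. -/
theorem hasMonochromaticCopy_of_chain {V : Type*} {s T k n : ℕ} (hk : 1 ≤ k) (hn : 1 ≤ n)
    {Γ : SimpleGraph (V × Fin T)} (χ : Γ.edgeSet → Fin s) (c : Fin s) (S : V → Finset (Fin T))
    (hS : ∀ v, 2 * k ≤ (S v).card) (l : List V) (hl : l.length = n) (hnd : l.Nodup)
    (hclique : ∀ v ∈ l, ∀ a ∈ S v, ∀ b ∈ S v, a ≠ b →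
      ∃ h : Γ.Adj (v, a) (v, b), χ ⟨s((v, a), (v, b)), h⟩ = c)
    (hchain : l.IsChain fun u v => ∃ P ⊆ S u, ∃ Q ⊆ S v, P.card = 2 * k ∧ Q.card = 2 * k ∧
      ∀ a ∈ P, ∀ b ∈ Q, ∃ h : Γ.Adj (u, a) (v, b), χ ⟨s((u, a), (v, b)), h⟩ = c) :
    HasMonochromaticCopy (graphPower (SimpleGraph.pathGraph n) k) χ := by
  classical
  obtain ⟨u, hu⟩ : ∃ u : ℕ → V, ∀ j (h : j < l.length), u j = l[j] :=
    ⟨fun j => if h : j < l.length then l[j] else l[0], fun j h => dif_pos h⟩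
  rw [List.isChain_iff_getElem] at hchain
  have hPQ : ∀ j, ∃ P Q : Finset (Fin T), j + 1 < n → P ⊆ S (u j) ∧ Q ⊆ S (u (j + 1)) ∧
      P.card = 2 * k ∧ Q.card = 2 * k ∧ ∀ a ∈ P, ∀ b ∈ Q,
        ∃ h : Γ.Adj (u j, a) (u (j + 1), b), χ ⟨s((u j, a), (u (j + 1), b)), h⟩ = c := by
    intro j
    by_cases hj : j + 1 < n
    · obtain ⟨P, hP, Q, hQ, h⟩ := hchain j (by omega)
      rw [← hu _ (by omega), ← hu _ (by omega)] at h
      rw [← hu _ (by omega)] at hP hQ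
      exact ⟨P, Q, fun _ => ⟨hP, hQ, h⟩⟩
    · exact ⟨∅, ∅, fun h => absurd h hj⟩
  choose P Q hPQ using hPQ
  -- The incoming set `Q` and the outgoing set `P` at a clique may overlap. Size `2 * k` lets `k`
  -- vertices be taken from the first and `k` others from the second.
  have he : ∀ j, ∃ e : ℕ → Fin T, j < n → (∀ x < 2 * k, e x ∈ S (u j)) ∧
      (∀ x < 2 * k, ∀ y < 2 * k, e x = e y → x = y) ∧
      (∀ i, i + 1 = j → ∀ x < k, e x ∈ Q i) ∧
      (j + 1 < n → ∀ x, k ≤ x → x < 2 * k → e x ∈ P j) := by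
    intro j
    obtain ⟨I₀, hI₀, hI₀c, hI₀Q⟩ : ∃ I₀ : Finset (Fin T), (j < n → I₀ ⊆ S (u j)) ∧
        (j < n → 2 * k ≤ I₀.card) ∧ ∀ i, i + 1 = j → I₀ ⊆ Q i := by
      cases j with
      | zero => exact ⟨S (u 0), fun _ => subset_rfl, fun _ => hS _, fun i hi => by omega⟩
      | succ j =>
        refine ⟨Q j, fun h => (hPQ j h).2.1, fun h => (hPQ j h).2.2.2.1.ge, fun i hi => ?_⟩
        obtain rfl : i = j := by omega
        exact subset_rfl
    obtain ⟨O₀, hO₀, hO₀c, hO₀P⟩ : ∃ O₀ : Finset (Fin T), O₀ ⊆ S (u j) ∧ 2 * k ≤ O₀.card ∧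
        (j + 1 < n → O₀ ⊆ P j) := by
      by_cases hj : j + 1 < n
      · exact ⟨P j, (hPQ j hj).1, (hPQ j hj).2.2.1.ge, fun _ => subset_rfl⟩
      · exact ⟨S (u j), subset_rfl, hS _, fun h => absurd h hj⟩
    by_cases hj : j < n
    · obtain ⟨I, hI, hIc⟩ := Finset.exists_subset_card_eq
        (show k ≤ I₀.card by have := hI₀c hj; omega)
      obtain ⟨O, hO, hOc⟩ := Finset.exists_subset_card_eq (show k ≤ (O₀ \ I).card by
        have := Finset.le_card_sdiff I O₀
        omega)
      obtain ⟨e, h1, h2, h3⟩ := exists_enumeration k hk I O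
        (Finset.disjoint_left.2 fun x hx hx' => (Finset.mem_sdiff.1 (hO hx')).2 hx) hIc hOc
      have hOO : O ⊆ O₀ := hO.trans Finset.sdiff_subset
      refine ⟨e, fun _ => ⟨fun x hx => ?_, h3, fun i hi x hx => hI₀Q i hi (hI (h1 x hx)),
        fun hj x hx hx' => hO₀P hj (hOO (h2 x hx hx'))⟩⟩
      rcases lt_or_ge x k with hxk | hxk
      · exact hI₀ hj (hI (h1 x hxk))
      · exact hO₀ (hOO (h2 x hxk hx))
    · obtain ⟨x, -⟩ : O₀.Nonempty := Finset.card_pos.1 (by omega)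
      exact ⟨fun _ => x, fun h => absurd h hj⟩
  choose e he using he
  have hdiv : ∀ p : Fin n, (p : ℕ) / (2 * k) < n := fun p =>
    lt_of_le_of_lt (Nat.div_le_self _ _) p.2
  have hmod : ∀ p : Fin n, (p : ℕ) % (2 * k) < 2 * k := fun p => Nat.mod_lt _ (by omega)
  have huinj : ∀ i < n, ∀ j < n, u i = u j → i = j := by
    intro i hi j hj h
    rw [hu i (by omega), hu j (by omega)] at h
    exact (hnd.getElem_inj_iff).1 h
  -- Position `p` is slot `p % (2 * k)` of block `p / (2 * k)`. Positions at most `k` apart in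
  -- different blocks lie in the last `k` slots of one block and the first `k` of the next.
  let f : Fin n → V × Fin T := fun p =>
    (u ((p : ℕ) / (2 * k)), e ((p : ℕ) / (2 * k)) ((p : ℕ) % (2 * k)))
  have hblock : ∀ i j x y, i < n → j < n → x < 2 * k → y < 2 * k → i ≤ j → j ≤ i + 1 →
      2 * k * i + x < 2 * k * j + y → 2 * k * j + y ≤ 2 * k * i + x + k →
      ∃ h : Γ.Adj (u i, e i x) (u j, e j y), χ ⟨s((u i, e i x), (u j, e j y)), h⟩ = c := by
    intro i j x y hi hj hx hy hij hji hlt hle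
    rcases hij.eq_or_lt with rfl | hij
    · refine hclique _ ?_ _ ((he i hi).1 x hx) _ ((he i hi).1 y hy) fun h => ?_
      · rw [hu i (by omega)]
        exact List.getElem_mem _
      · have := (he i hi).2.1 x hx y hy h
        omega
    · obtain rfl : j = i + 1 := by omega
      rw [mul_add] at hlt hle
      exact (hPQ i hj).2.2.2.2 _ ((he i hi).2.2.2 hj x (by omega) hx) _
        ((he (i + 1) hj).2.2.1 i rfl y (by omega))
  have hlt : ∀ p q : Fin n, p < q → (q : ℕ) ≤ p + k →
      ∃ h : Γ.Adj (f p) (f q), χ ⟨s(f p, f q), h⟩ = c := by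
    intro p q hpq hqk
    have hpq' : (p : ℕ) < q := hpq
    have h2 : (q : ℕ) / (2 * k) ≤ (p : ℕ) / (2 * k) + 1 := by
      rw [← Nat.add_div_right _ (by omega : 0 < 2 * k)]
      exact Nat.div_le_div_right (by omega)
    exact hblock _ _ _ _ (hdiv p) (hdiv q) (hmod p) (hmod q) (Nat.div_le_div_right hpq'.le) h2
      (by rwa [Nat.div_add_mod, Nat.div_add_mod]) (by rwa [Nat.div_add_mod, Nat.div_add_mod])
  have hadj : ∀ p q : Fin n, (graphPower (SimpleGraph.pathGraph n) k).Adj p q →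
      ∃ h : Γ.Adj (f p) (f q), χ ⟨s(f p, f q), h⟩ = c := by
    rintro p q ⟨hne, hd⟩
    obtain ⟨w, hw⟩ := (edist_le_iff_exists_walk _ _ _ _).1 hd
    have := pathGraph_walk_length w
    rcases lt_or_gt_of_ne hne with h | h
    · exact hlt p q h (by omega)
    · obtain ⟨h1, h2⟩ := hlt q p h (by omega)
      refine ⟨h1.symm, ?_⟩
      rw [← h2]
      congr 2
      exact Sym2.eq_swap
  refine ⟨⟨⟨f, fun {p q} h => (hadj p q h).1⟩, ?_⟩, c, ?_⟩
  · intro p q hpq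
    have h1 : f p = f q := hpq
    simp only [f, Prod.mk.injEq] at h1
    have h2 := huinj _ (hdiv p) _ (hdiv q) h1.1
    rw [h2] at h1
    have h3 := (he _ (hdiv q)).2.1 _ (hmod p) _ (hmod q) h1.2
    ext
    rw [← Nat.div_add_mod (p : ℕ) (2 * k), h2, h3, Nat.div_add_mod]
  · rintro ⟨e, he⟩
    induction e using Sym2.ind with
    | _ p q => exact (hadj p q he).2

/-- If few `b ∈ U` are `good` for each `a ∈ A`, and all others but one are `blue`, then `A` is
completely `blue` to a large subset of `U`. -/
theorem exists_common_subset {α : Type*} (m : ℕ) (hm : 1 ≤ m) (A U : Finset α)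
    (good blue : α → α → Prop) (hA : A.card = m) (hU : 4 * m ≤ U.card)
    (h : ∀ a ∈ A, ∀ U' ⊆ U, (∀ b ∈ U', good a b) → U'.card * (2 * m) < U.card)
    (hother : ∀ a ∈ A, ∀ b ∈ U, ∀ b' ∈ U, ¬ good a b → ¬ blue a b → ¬ good a b' → ¬ blue a b' →
      b = b') : ∃ B ⊆ U, B.card = m ∧ ∀ a ∈ A, ∀ b ∈ B, blue a b := by
  classical
  let bad : α → Finset α := fun a =>
    (U.filter fun b => good a b) ∪ (U.filter fun b => ¬ good a b ∧ ¬ blue a b)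
  have hbad : ∀ a ∈ A, (bad a).card * (2 * m) ≤ U.card + 2 * m := by
    intro a ha
    have h1 := h a ha (U.filter fun b => good a b) (Finset.filter_subset _ _)
      fun b hb => (Finset.mem_filter.1 hb).2
    have h2 : (U.filter fun b => ¬ good a b ∧ ¬ blue a b).card ≤ 1 := by
      refine Finset.card_le_one.2 fun b hb b' hb' => ?_
      obtain ⟨hb1, hb2, hb3⟩ := Finset.mem_filter.1 hb
      obtain ⟨hb1', hb2', hb3'⟩ := Finset.mem_filter.1 hb'
      exact hother a ha b hb1 b' hb1' hb2 hb3 hb2' hb3'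
    have h3 := Finset.card_union_le (U.filter fun b => good a b)
      (U.filter fun b => ¬ good a b ∧ ¬ blue a b)
    calc (bad a).card * (2 * m) ≤ ((U.filter fun b => good a b).card + 1) * (2 * m) :=
          Nat.mul_le_mul_right _ (h3.trans (by omega))
      _ ≤ _ := by rw [add_mul]; omega
  have hsum : (A.biUnion bad).card * (2 * m) ≤ m * (U.card + 2 * m) := by
    calc _ ≤ (∑ a ∈ A, (bad a).card) * (2 * m) :=
          Nat.mul_le_mul_right _ Finset.card_biUnion_le
      _ = ∑ a ∈ A, (bad a).card * (2 * m) := Finset.sum_mul _ _ _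
      _ ≤ ∑ _a ∈ A, (U.card + 2 * m) := Finset.sum_le_sum hbad
      _ = _ := by rw [Finset.sum_const, hA, smul_eq_mul]
  -- Together the `m` elements of `A` spoil at most `|U| / 2 + m` elements of `U`, and `4 * m ≤ |U|`
  -- leaves `m` unspoilt.
  have h2 : 2 * (A.biUnion bad).card ≤ U.card + 2 * m :=
    Nat.le_of_mul_le_mul_left (by linarith [hsum] : m * _ ≤ m * _) hm
  obtain ⟨B, hB, hBc⟩ := Finset.exists_subset_card_eq (show m ≤ (U \ A.biUnion bad).card by
    have := Finset.le_card_sdiff (A.biUnion bad) U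
    omega)
  refine ⟨B, hB.trans Finset.sdiff_subset, hBc, fun a ha b hb => ?_⟩
  obtain ⟨hbU, hb'⟩ := Finset.mem_sdiff.1 (hB hb)
  by_contra hblue
  refine hb' (Finset.mem_biUnion.2 ⟨a, ha, ?_⟩)
  by_cases hg : good a b
  · exact Finset.mem_union_left _ (Finset.mem_filter.2 ⟨hbU, hg⟩)
  · exact Finset.mem_union_right _ (Finset.mem_filter.2 ⟨hbU, hg, hblue⟩)

/-! ### Pseudorandom subgraphs and simultaneous matchings -/

open Classical in
theorem edgeDensity_eq_div {V : Type*} (G : SimpleGraph V) (X Y : Finset V) (m : ℕ)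
    (hX : X.card = m) (hY : Y.card = m) :
    (G.edgeDensity X Y : ℝ) = ((G.interedges X Y).card : ℝ) / (m * m) := by
  rw [SimpleGraph.edgeDensity_def, hX, hY]
  push_cast
  rfl

open Classical in
/-- Inside any set of `2⌈an⌉` vertices of a pseudorandom graph there is a sparse pseudorandom
graph on `⌈an⌉` vertices. -/
theorem exists_pseudorandom_subgraph {a b c ε A B : ℝ} {t T n : ℕ}
    (hgood : IsGoodQuadruple a b c ε) (htT : t ≤ T) (hn : 9 ≤ n) {V : Type*} [Fintype V]
    (G : SimpleGraph V) (hG : IsPseudorandom A B c T (ε / 8) n G) (U : Finset V)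
    (hU : U.card = 2 * ⌈a * n⌉₊) :
    ∃ (φ : Fin ⌈a * n⌉₊ ↪ V) (H : SimpleGraph (Fin ⌈a * n⌉₊)), (∀ x, φ x ∈ U) ∧
      (∀ x y, H.Adj x y → G.Adj (φ x) (φ y)) ∧ IsPseudorandom a b c t ε n H := by
  obtain ⟨ha, hb, hc, hε, hca, hab, hε1⟩ := hgood
  have hn0 : (9 : ℝ) ≤ n := by exact_mod_cast hn
  have hh : 1 ≤ ⌈a * n⌉₊ := Nat.one_le_ceil_iff.2 (by positivity)
  have hm : 1 ≤ ⌈c * n⌉₊ := Nat.one_le_ceil_iff.2 (by positivity)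
  have hmh : ⌈c * n⌉₊ ≤ ⌈a * n⌉₊ := Nat.ceil_le_ceil (by nlinarith)
  have hm' : c * n ≤ ⌈c * n⌉₊ := Nat.le_ceil _
  -- Rounding up costs at most a factor `10 / 9`, as `a ≥ 1` and `n ≥ 9`.
  have hh' : (⌈a * n⌉₊ : ℝ) ≤ 10 / 9 * (a * n) := by
    have := (Nat.ceil_lt_add_one (by positivity : 0 ≤ a * n)).le
    nlinarith
  generalize hdef : ⌈a * n⌉₊ = h at *
  set m := ⌈c * n⌉₊ with hmdef
  have hm0 : (0 : ℝ) < m := by exact_mod_cast hm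
  obtain ⟨f, hf, hfG⟩ := hG.density
  obtain ⟨H, hHG, f', hf', hf'U, hH⟩ := exists_sparse_subgraph G U
    (Finset.card_pos.1 (by omega)) m hm ε f hε (by linarith) hf (by
      intro X _ Y _ hd hx hy
      have := hfG X Y hd hx hy
      rw [edgeDensity_eq_div G X Y m hx hy, le_div_iff₀ (by positivity),
        div_le_iff₀ (by positivity)] at this
      constructor <;> linarith [this.1, this.2])
  rw [hU] at hf'U
  push_cast at hf'U
  -- Origin of the constant 264: it exceeds `4 * 1.1 * 48 * (100 / 81)`, where 48 comes from `24 *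
  -- |U|` with `|U| = 2 * h`.
  have hDb : 4 * ((1 + ε) * f') * h ≤ b := by
    refine le_trans ?_ hab
    rw [le_div_iff₀ (by positivity)]
    have h0 : (0 : ℝ) < n := by linarith
    have h1 : (c * n) ^ 2 ≤ (m : ℝ) ^ 2 := pow_le_pow_left₀ (by positivity) hm' 2
    have h2 : (h : ℝ) ^ 2 ≤ (10 / 9 * (a * n)) ^ 2 := pow_le_pow_left₀ (by positivity) hh' 2
    have h3 : ε ^ 2 * (c * n) ^ 2 * f' * h ≤ 48 * (h : ℝ) ^ 2 := by
      calc _ ≤ ε ^ 2 * (m : ℝ) ^ 2 * f' * h := by gcongr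
        _ = ε ^ 2 * (m * (m * f')) * h := by ring
        _ ≤ 24 * (2 * h) * h := by gcongr
        _ = _ := by ring
    have h4 : (f' * h * (ε ^ 2 * c ^ 2)) * n ^ 2 ≤ (48 * (100 / 81) * a ^ 2) * n ^ 2 := by
      nlinarith
    have h5 := le_of_mul_le_mul_right h4 (by positivity)
    have h6 : 0 ≤ f' * h * (ε ^ 2 * c ^ 2) := by positivity
    nlinarith [sq_nonneg a]
  obtain ⟨W, hWU, hWc, hW⟩ := exists_half_small_degree H U h m hU hm hmh ((1 + ε) * f') b hb
    (fun X hX Y hY hd hx hy => by have := (hH X hX Y hY hd hx hy).2; linarith) hDb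
  let φ : Fin h ↪ V := (W.equivFinOfCardEq hWc).symm.toEmbedding.trans (Function.Embedding.subtype _)
  have hφ : ∀ x, φ x ∈ W := fun x => ((W.equivFinOfCardEq hWc).symm x).2
  have hmap : ∀ X : Finset (Fin h), X.map φ ⊆ U := fun X v hv => by
    obtain ⟨x, -, rfl⟩ := Finset.mem_map.1 hv
    exact hWU (hφ x)
  obtain ⟨K, hK⟩ : ∃ K : SimpleGraph (Fin h), ∀ x y, K.Adj x y ↔ H.Adj (φ x) (φ y) :=
    ⟨H.comap φ, fun _ _ => Iff.rfl⟩
  refine ⟨φ, K, fun x => hWU (hφ x), fun x y hxy => hHG ((hK x y).1 hxy), ?_, ?_, ?_, ?_⟩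
  · simp [hdef]
  · have : Nonempty (Fin h) := ⟨⟨0, hh⟩⟩
    obtain ⟨v, hv⟩ := K.exists_maximal_degree_vertex
    rw [hv]
    refine le_trans ?_ (hW (φ v) (hφ v))
    rw [← SimpleGraph.card_neighborFinset_eq_degree, ← Finset.card_map φ]
    refine Nat.cast_le.2 (Finset.card_le_card fun y hy => ?_)
    obtain ⟨x, hx, rfl⟩ := Finset.mem_map.1 hy
    rw [SimpleGraph.mem_neighborFinset, hK] at hx
    exact Finset.mem_filter.2 ⟨hWU (hφ x), hx⟩
  · refine ⟨f', hf', fun X Y hd hx hy => ?_⟩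
    have h1 := hH (X.map φ) (hmap X) (Y.map φ) (hmap Y) ((Finset.disjoint_map φ).2 hd)
      (by rw [Finset.card_map, hx]) (by rw [Finset.card_map, hy])
    have h2 : ((K.interedges X Y).card : ℝ) =
        (H.interedges (X.map φ) (Y.map φ)).card := by
      rw [card_interedges_eq_sum, card_interedges_eq_sum]
      simp only [Finset.sum_map, hK]
    rw [edgeDensity_eq_div _ X Y m hx hy, h2, le_div_iff₀ (by positivity),
      div_le_iff₀ (by positivity)]
    constructor <;> linarith [h1.1, h1.2]
  · intro v w hw
    let ψ : K →g G := ⟨φ, fun {x y} hxy => hHG ((hK x y).1 hxy)⟩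
    have := hG.no_short_cycle _ (w.map ψ)
      ((SimpleGraph.Walk.isCycle_map_iff_of_injective (f := ψ) φ.injective).2 hw)
    rw [SimpleGraph.Walk.length_map] at this
    omega

/-- Most vertices of `X i₀` can be matched simultaneously into all the sets `X i`. -/
theorem exists_simultaneous_matching {V : Type*} [Fintype V] (G : SimpleGraph V) {t m M : ℕ}
    (X : Fin t → Finset V) (hX : ∀ i, (X i).card = M)
    (hdisj : ∀ i j, i ≠ j → Disjoint (X i) (X j)) (i₀ : Fin t)
    (hedge : ∀ X' Y' : Finset V, Disjoint X' Y' → X'.card = m → Y'.card = m →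
      ∃ x ∈ X', ∃ y ∈ Y', G.Adj x y) :
    ∃ U ⊆ X i₀, M ≤ U.card + t * m ∧ ∃ g : Fin t → V → V,
      (∀ i, Set.InjOn (g i) U) ∧ ∀ i, ∀ x ∈ U, g i x ∈ X i ∧ G.edist x (g i x) ≤ 1 := by
  classical
  have key : ∀ j, ∃ X' ⊆ X i₀, M ≤ X'.card + m ∧ ∃ g : V → V, Set.InjOn g X' ∧
      ∀ x ∈ X', g x ∈ X j ∧ G.edist x (g x) ≤ 1 := by
    intro j
    by_cases hj : i₀ = j
    · subst hj
      -- `X i₀` is matched to itself by the identity, hence distance at most 1 instead of adjacency.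
      exact ⟨X i₀, subset_rfl, by rw [hX]; omega, id, Set.injOn_id _, fun x hx => ⟨hx, by simp⟩⟩
    · obtain ⟨X', hX', hc, g, hg, hgX⟩ := exists_partial_matching G m (X i₀) (X j) (hdisj _ _ hj)
        (by rw [hX, hX]) hedge
      rw [hX] at hc
      exact ⟨X', hX', hc, g, hg, fun x hx =>
        ⟨(hgX x hx).1, (SimpleGraph.edist_eq_one_iff_adj.2 (hgX x hx).2).le⟩⟩
  choose X' hX' hc g hg hgX using key
  refine ⟨(X i₀).filter fun x => ∀ j, x ∈ X' j, Finset.filter_subset _ _, ?_, g, ?_, ?_⟩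
  · have h1 : X i₀ ⊆ ((X i₀).filter fun x => ∀ j, x ∈ X' j) ∪
        Finset.univ.biUnion fun j => X i₀ \ X' j := by
      intro x hx
      by_cases h : ∀ j, x ∈ X' j
      · exact Finset.mem_union_left _ (Finset.mem_filter.2 ⟨hx, h⟩)
      · push Not at h
        obtain ⟨j, hj⟩ := h
        exact Finset.mem_union_right _ (Finset.mem_biUnion.2
          ⟨j, Finset.mem_univ _, Finset.mem_sdiff.2 ⟨hx, hj⟩⟩)
    have h2 : (Finset.univ.biUnion fun j => X i₀ \ X' j).card ≤ t * m := by
      have := Finset.card_biUnion_le_card_mul (Finset.univ : Finset (Fin t))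
        (fun j => X i₀ \ X' j) m fun j _ => by
          rw [Finset.card_sdiff_of_subset (hX' j), hX]
          have := hc j
          omega
      simpa using this
    have h3 := (Finset.card_le_card h1).trans (Finset.card_union_le _ _)
    rw [hX] at h3
    omega
  · exact fun i x hx y hy => hg i ((Finset.mem_filter.1 hx).2 i) ((Finset.mem_filter.1 hy).2 i)
  · exact fun i x hx => hgX i x ((Finset.mem_filter.1 hx).2 i)

theorem IsPseudorandom.exists_adj {V : Type*} [Fintype V] {a b c ε : ℝ} {t n : ℕ}
    {G : SimpleGraph V} (hG : IsPseudorandom a b c t ε n G) (hε : ε < 1) (X Y : Finset V)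
    (hXY : Disjoint X Y) (hX : X.card = ⌈c * n⌉₊) (hY : Y.card = ⌈c * n⌉₊) :
    ∃ x ∈ X, ∃ y ∈ Y, G.Adj x y := by
  classical
  obtain ⟨f, hf, hfG⟩ := hG.density
  have h1 := (hfG X Y hXY hX hY).1
  rw [edgeDensity_eq_div G X Y _ hX hY] at h1
  by_contra! hno
  rw [card_interedges_eq_sum, Finset.sum_eq_zero fun x hx => Finset.sum_eq_zero fun y hy =>
    if_neg (hno x hx y hy), zero_div] at h1
  nlinarith

theorem IsPseudorandom.exists_finset_edist_le {V : Type*} [Fintype V] {a b c ε : ℝ} {t n : ℕ}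
    {G : SimpleGraph V} (hG : IsPseudorandom a b c t ε n G) (R : ℕ) (v : V) :
    ∃ N : Finset V, N.card ≤ (⌈b⌉₊ + 1) ^ R ∧ ∀ u, G.edist v u ≤ R → u ∈ N := by
  classical
  refine _root_.exists_finset_edist_le G ⌈b⌉₊ (fun v => ?_) R v
  have h1 := (G.degree_le_maxDegree v)
  have h2 := hG.maxDegree_le.trans (Nat.le_ceil b)
  rw [SimpleGraph.card_neighborFinset_eq_degree]
  refine h1.trans ?_
  convert Nat.cast_le.1 h2

/-! ### The induction step -/

theorem mainTheorem4 (k s r t : ℕ) (hk : 1 ≤ k) (hs : 1 ≤ s) (hr : 1 ≤ r) (ht : 2 ≤ t)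
    (a b c ε : ℝ) (hgood : IsGoodQuadruple a b c ε) :
    ∃ (R T : ℕ) (A B C δ : ℝ), 1 ≤ R ∧ 1 ≤ T ∧ IsGoodQuadruple A B C δ ∧
      ∃ n₀ : ℕ, ∀ n : ℕ, n₀ ≤ n →
        ∀ (V : Type*) [Fintype V] (G : SimpleGraph V), IsPseudorandom A B C T δ n G →
        ∀ Γ : SimpleGraph (V × Fin T), IsShearedBlowup (graphPower G R) T Γ →
        ∀ χ : Γ.edgeSet → Fin s,
          HasMonochromaticCopy (graphPower (SimpleGraph.pathGraph n) k) χ ∨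
          ∃ (W : Type) (_ : Fintype W) (H : SimpleGraph W), IsPseudorandom a b c t ε n H ∧
            ∃ Λ : SimpleGraph (W × Fin t), IsShearedBlowup (graphPower H r) t Λ ∧
              ∃ f : SimpleGraph.Copy Λ Γ, (coloursOnCopy χ f).ncard ≤ s - 1 := by
  classical
  have ha := hgood.a_pos
  have hc := hgood.c_pos
  have hε := hgood.ε_pos
  have hε1 := hgood.ε_lt
  have hs0 : (1 : ℝ) ≤ s := by exact_mod_cast hs
  have ht0 : (2 : ℝ) ≤ t := by exact_mod_cast ht
  have h2t : (1 : ℝ) ≤ 2 ^ t := one_le_pow₀ (by norm_num)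
  -- The factor `s` pays for the majority colour, `2 ^ t` for the repeated splitting, and the
  -- bracket for `2 * h + t * m + n` after rounding.
  set A : ℝ := s * (2 ^ t * (2 * (a + 1) + t * (c + 1) + 1)) with hA
  have hA1 : 2 * c + 1 ≤ A := by
    have h1 : 2 * c + 1 ≤ 2 * (a + 1) + t * (c + 1) + 1 := by nlinarith
    have h2 : 1 ≤ s * (2 : ℝ) ^ t := one_le_mul_of_one_le_of_one_le hs0 h2t
    rw [hA, ← mul_assoc]
    nlinarith
  have hA0 : 0 < A := by linarith
  set B : ℝ := 264 * A ^ 2 / ((ε / 8) ^ 2 * c ^ 2) with hB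
  -- `D` bounds the balls of radius `r + 2` in `G`, and `L` is the clique size that the greedy
  -- choice then needs.
  set D : ℕ := (⌈B⌉₊ + 1) ^ (r + 2) with hD
  set L : ℕ := (D * (2 * k) + 4 * (2 * k) + 1) * (2 * (2 * k)) ^ D with hL
  have hLk : 2 * k ≤ L := by
    have : 0 < (2 * (2 * k)) ^ D := by positivity
    exact (by omega : 2 * k ≤ D * (2 * k) + 4 * (2 * k) + 1).trans (Nat.le_mul_of_pos_right _ this)
  obtain ⟨N, hN⟩ := exists_ramsey_number (fun _ : Fin s => L)
  -- `T ≥ N` gives the Ramsey cliques, `T ≥ t` lets the girth condition pass to `H`.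
  set T : ℕ := max N t with hT
  refine ⟨r + 2, T, A, B, c, ε / 8, by omega, by omega,
    ⟨hA0, by positivity, hc, by positivity, hA1, le_rfl, by linarith⟩, 9, ?_⟩
  intro n hn V _ G hG Γ hΓ χ
  have hn0 : (9 : ℝ) ≤ n := by exact_mod_cast hn
  let blue : Fin s → V × Fin T → V × Fin T → Prop := fun i x y =>
    ∃ h : Γ.Adj x y, χ ⟨s(x, y), h⟩ = i
  have hbsymm : ∀ i x y, blue i x y → blue i y x := by
    rintro i x y ⟨h, hi⟩
    refine ⟨h.symm, ?_⟩
    rw [← hi]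
    congr 2
    exact Sym2.eq_swap
  have hmono : ∀ v, ∃ (i : Fin s) (S : Finset (Fin T)), S.card = L ∧
      ∀ x ∈ S, ∀ y ∈ S, x ≠ y → blue i (v, x) (v, y) := by
    intro v
    obtain ⟨i, S, -, hS, hSi⟩ := hN (Fin T) Finset.univ
      -- The default colour is met only for `x = y`, because `C(v)` is a clique.
      (fun x y => if h : s((v, x), (v, y)) ∈ Γ.edgeSet then χ ⟨_, h⟩ else ⟨0, hs⟩)
      (fun x y => by simp only [Sym2.eq_swap (a := (v, x))]) (by simp [hT])
    refine ⟨i, S, hS, fun x hx y hy hxy => ?_⟩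
    have hadj := hΓ.2.1 v x y hxy
    have := hSi x hx y hy hxy
    rw [dif_pos (show s((v, x), (v, y)) ∈ Γ.edgeSet from hadj)] at this
    exact ⟨hadj, this⟩
  choose col S hSL hSmono using hmono
  set h : ℕ := ⌈a * n⌉₊ with hh
  set m : ℕ := ⌈c * n⌉₊ with hm
  set M : ℕ := 2 * h + t * m with hM
  have hcardV : s * (2 ^ t * (M + n)) ≤ Fintype.card V := by
    rw [hG.card_eq]
    have h1 : (h : ℝ) ≤ (a + 1) * n := by
      have := (Nat.ceil_lt_add_one (by positivity : 0 ≤ a * n)).le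
      rw [← hh] at this
      nlinarith
    have h2 : (m : ℝ) ≤ (c + 1) * n := by
      have := (Nat.ceil_lt_add_one (by positivity : 0 ≤ c * n)).le
      rw [← hm] at this
      nlinarith
    have h3 : ((s * (2 ^ t * (M + n)) : ℕ) : ℝ) ≤ A * n := by
      push_cast [hM]
      calc (s : ℝ) * (2 ^ t * (2 * h + t * m + n))
          ≤ s * (2 ^ t * (2 * ((a + 1) * n) + t * ((c + 1) * n) + n)) := by gcongr
        _ = A * n := by rw [hA]; ring
    exact_mod_cast h3.trans (Nat.le_ceil _)
  obtain ⟨i, -, hi⟩ := Finset.exists_le_card_fiber_of_mul_le_card_of_maps_to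
    (s := (Finset.univ : Finset V)) (t := (Finset.univ : Finset (Fin s))) (f := col)
    (n := 2 ^ t * (M + n)) (fun _ _ => Finset.mem_univ _) ⟨⟨0, hs⟩, Finset.mem_univ _⟩
    (by simpa using hcardV)
  set Vi := (Finset.univ : Finset V).filter fun v => col v = i with hVi
  let F : V → V → Prop := fun u v => ∃ P ⊆ S u, ∃ Q ⊆ S v, P.card = 2 * k ∧ Q.card = 2 * k ∧
      ∀ x ∈ P, ∀ y ∈ Q, blue i (u, x) (v, y)
  have hFsymm : ∀ u v, F u v → F v u := by
    rintro u v ⟨P, hP, Q, hQ, h1, h2, h3⟩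
    exact ⟨Q, hQ, P, hP, h2, h1, fun x hx y hy => hbsymm _ _ _ (h3 y hy x hx)⟩
  by_cases hpath : ∃ l : List V, l.Nodup ∧ l.IsChain F ∧ (∀ x ∈ l, x ∈ Vi) ∧ l.length = n
  · left
    obtain ⟨l, hnd, hch, hlV, hln⟩ := hpath
    refine hasMonochromaticCopy_of_chain hk (by omega) χ i S (fun v => by rw [hSL]; exact hLk) l
      hln hnd (fun v hv x hx y hy hxy => ?_) hch
    have := hSmono v x hx y hy hxy
    rwa [(Finset.mem_filter.1 (hlV v hv)).2] at this
  right
  push Not at hpath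
  obtain ⟨X, hXV, hXM, hX⟩ := exists_separated_family F hFsymm n M t Vi (by omega) hpath
  obtain ⟨U₀, hU₀, hU₀c, g, hg, hgX⟩ := exists_simultaneous_matching G X hXM (fun i j hij => (hX i j hij).1)
    ⟨0, by omega⟩ (hG.exists_adj (by linarith))
  obtain ⟨U, hU, hUc⟩ := Finset.exists_subset_card_eq (show 2 * h ≤ U₀.card by
    have : M ≤ U₀.card + t * m := hU₀c
    omega)
  obtain ⟨φ, H, hφ, hHG, hHP⟩ := exists_pseudorandom_subgraph hgood (le_max_right N t) hn G hG U hUc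
  -- Only pairs in different sets `X p` are constrained; the shearing removes the edges within one
  -- of them.
  let conf : V → V → Prop := fun u v => ∃ p q, p ≠ q ∧ u ∈ X p ∧ v ∈ X q ∧ G.edist u v ≤ (r + 2 : ℕ)
  let good : V → V → Fin T → Fin T → Prop := fun u v x y =>
    Γ.Adj (u, x) (v, y) ∧ ¬ blue i (u, x) (v, y)
  obtain ⟨rep, -, hrep⟩ := exists_representatives conf
    (by
      rintro u v ⟨p, q, hpq, hu, hv, hd⟩
      exact ⟨q, p, hpq.symm, hv, hu, by rwa [SimpleGraph.edist_comm]⟩)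
    (by
      rintro v ⟨p, q, hpq, hu, hv, -⟩
      exact Finset.disjoint_left.1 (hX p q hpq).1 hu hv)
    D (2 * k) (D * (2 * k) + 4 * (2 * k) + 1) (by omega)
    (by
      intro v
      obtain ⟨N, hN, hNv⟩ := hG.exists_finset_edist_le (r + 2) v
      exact ⟨N, hN, fun u ⟨_, _, _, _, _, hd⟩ => hNv u hd⟩)
    good (fun u v x y hgd => ⟨hgd.1.symm, fun hb => hgd.2 (hbsymm _ _ _ hb)⟩)
    S (fun v => (hSL v).ge) le_rfl
    (by
      rintro v u ⟨p, q, hpq, hv, hu, hd⟩ Y hY hYc P hP hPg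
      by_contra hlt
      obtain ⟨P', hP', hP'c⟩ := Finset.exists_subset_card_eq (not_lt.1 hlt)
      have hvu : v ≠ u := fun h => Finset.disjoint_left.1 (hX p q hpq).1 hv (h ▸ hu)
      obtain ⟨σ, hσ⟩ := hΓ.2.2 v u ⟨hvu, hd⟩
      -- Too many harmful choices would create a link between `X p` and `X q`. The one exceptional
      -- vertex is the partner in the removed perfect matching of `Γ`.
      obtain ⟨Q, hQ, hQc, hPQ⟩ := exists_common_subset (2 * k) (by omega) P' Y (good v u)
        (fun x y => blue i (v, x) (u, y)) hP'c hYc (fun x hx => hPg x (hP' hx)) (by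
          intro x _ y _ y' _ h1 h2 h3 h4
          have e1 : ¬ Γ.Adj (v, x) (u, y) := fun h => h1 ⟨h, h2⟩
          have e2 : ¬ Γ.Adj (v, x) (u, y') := fun h => h3 ⟨h, h4⟩
          rw [hσ, not_not] at e1 e2
          rw [e1, e2])
      exact (hX p q hpq).2 v hv u hu ⟨P', hP'.trans hP, Q, hQ.trans hY, hP'c, hQc, hPQ⟩)
  -- The blow-up sheared by the identity permutation along every edge.
  let Λ : SimpleGraph (Fin h × Fin t) :=
    { Adj := fun x y => x.2 ≠ y.2 ∧ (x.1 = y.1 ∨ (graphPower H r).Adj x.1 y.1)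
      symm := ⟨fun _ _ h => ⟨h.1.symm, h.2.imp Eq.symm fun h => h.symm⟩⟩
      loopless := ⟨fun _ h => h.1 rfl⟩ }
  let f : Fin h × Fin t → V × Fin T := fun x => (g x.2 (φ x.1), rep (g x.2 (φ x.1)))
  have hφU : ∀ w, φ w ∈ U₀ := fun w => hU (hφ w)
  have hfgood : ∀ x y, Λ.Adj x y → Γ.Adj (f x) (f y) ∧ ¬ blue i (f x) (f y) := by
    rintro x y ⟨hne, hxy⟩
    refine hrep _ _ ⟨x.2, y.2, hne, (hgX _ _ (hφU _)).1, (hgX _ _ (hφU _)).1, ?_⟩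
    have h1 : G.edist (g x.2 (φ x.1)) (φ x.1) ≤ 1 := by
      rw [SimpleGraph.edist_comm]; exact (hgX _ _ (hφU _)).2
    have h2 : G.edist (φ x.1) (φ y.1) ≤ r := by
      rcases hxy with hxy | hxy
      · rw [hxy]; simp
      · exact edist_map_le (⟨φ, fun {x y} h => hHG x y h⟩ : H →g G) hxy.2
    have h3 : G.edist (φ y.1) (g y.2 (φ y.1)) ≤ 1 := (hgX _ _ (hφU _)).2
    calc _ ≤ _ := SimpleGraph.edist_triangle (v := φ x.1)
      _ ≤ _ := add_le_add h1 (SimpleGraph.edist_triangle (v := φ y.1))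
      _ ≤ 1 + (r + 1) := add_le_add le_rfl (add_le_add h2 h3)
      _ = ((r + 2 : ℕ) : ℕ∞) := by push_cast; ring
  have hfinj : Function.Injective f := by
    rintro ⟨w, p⟩ ⟨w', q⟩ heq
    have h1 : g p (φ w) = g q (φ w') := congrArg Prod.fst heq
    have hpq : p = q := by
      by_contra hpq
      exact Finset.disjoint_left.1 (hX p q hpq).1 (hgX p _ (hφU w)).1
        (h1 ▸ (hgX q _ (hφU w')).1)
    subst hpq
    rw [φ.injective (hg p (hφU w) (hφU w') h1)]
  refine ⟨Fin h, inferInstance, H, hHP, Λ, ⟨?_, ?_, ?_⟩,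
    ⟨⟨f, fun {x y} hxy => (hfgood x y hxy).1⟩, hfinj⟩, ?_⟩
  · rintro x y ⟨hne, hxy | hxy⟩
    · exact Or.inl ⟨hxy, hne⟩
    · exact Or.inr hxy
  · exact fun u p q hpq => ⟨hpq, Or.inl rfl⟩
  · exact fun u v huv => ⟨1, fun p q => ⟨fun h => h.1.symm, fun h => ⟨h.symm, Or.inr huv⟩⟩⟩
  · have hsub : coloursOnCopy χ (⟨⟨f, fun {x y} hxy => (hfgood x y hxy).1⟩, hfinj⟩ :
        SimpleGraph.Copy Λ Γ) ⊆ {i}ᶜ := by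
      rintro _ ⟨⟨e, he⟩, rfl⟩ hi
      induction e using Sym2.ind with
      | _ x y => exact (hfgood x y he).2 ⟨(hfgood x y he).1, hi⟩
    refine (Set.ncard_le_ncard hsub (Set.toFinite _)).trans ?_
    have := Set.ncard_add_ncard_compl ({i} : Set (Fin s))
    rw [Set.ncard_singleton, Nat.card_fin] at this
    omega
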